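/- Let $k>1$ be an integer and let $D>0$ be a non-square discriminant (an integer with $D\equiv 0,1 \pmod 4$ that is not a perfect square). Let $\mathcal{Q}_D$ be the set of integral binary quadratic forms $Q=[a,b,c]$, $Q(X,Y)=aX^2+bXY+cY^2$, with $b^2-4ac=D$. Write $\tau=x+iy\in\mathbb{H}$, put $$\psi(v):=\frac12\int_0^v u^{k-\frac32}(1-u)^{-\frac12}\,du,\qquad g_Q(\tau):=\operatorname{sgn}\left(a|\tau|^2+bx+c\right)Q(\tau,1)^{k-1}\,\psi\!\left(\frac{Dy^2}{|Q(\tau,1)|^2}\right)$$ (with $\operatorname{sgn}(0)=0$), and $$\mathcal{F}_{1-k,D}(\tau):=\frac{D^{\frac12-k}}{\binom{2k-2}{k-1}\pi}\sum_{Q\in\mathcal{Q}_D}g_Q(\tau),\qquad \mathcal{F}_{1-k,D,\mathcal{A}}(\tau):=\frac{(-1)^kD^{\frac12-k}}{\binom{2k-2}{k-1}\pi}\sum_{Q\in\mathcal{A}}g_Q(\tau)$$ for every narrow class $\mathcal{A}\subseteq\mathcal{Q}_D$, that is, every $\mathrm{SL}_2(\mathbb{Z})$-equivalence class of forms in $\mathcal{Q}_D$.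 Let $E_D:=\bigcup_{Q\in\mathcal{Q}_D}S_Q$, where $S_Q:=\{\tau\in\mathbb{H}: a|\tau|^2+bx+c=0\}$. Then the series defining $\mathcal{F}_{1-k,D}$ and each $\mathcal{F}_{1-k,D,\mathcal{A}}$ converge absolutely, and uniformly on compact subsets of $\mathbb{H}$, and each of these functions is a locally harmonic Maass form of weight $2-2k$ for $\mathrm{SL}_2(\mathbb{Z})$ with exceptional set $E_D$. That is, if $\mathcal{F}$ is any of these functions, then: 1. $(c\tau+d)^{2k-2}\,\mathcal{F}\!\left(\frac{a\tau+b}{c\tau+d}\right)=\mathcal{F}(\tau)$ for all $\left(\begin{smallmatrix}a&b\\c&d\end{smallmatrix}\right)\in\mathrm{SL}_2(\mathbb{Z})$ and all $\tau\in\mathbb{H}$. 2. Every $\tau\in\mathbb{H}\setminus E_D$ has a neighborhood on which $\mathcal{F}$ is real analytic and $\Delta_{2-2k}(\mathcal{F})=0$, where $$\Delta_{2-2k}:=-y^2\left(\frac{\partial^2}{\partial x^2}+\frac{\partial^2}{\partial y^2}\right)+i(2-2k)y\left(\frac{\partial}{\partial x}+i\frac{\partial}{\partial y}\right).$$ 3.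 For $\tau\in E_D$ one has $\mathcal{F}(\tau)=\frac12\lim_{w\to0^+}\left(\mathcal{F}(\tau+iw)+\mathcal{F}(\tau-iw)\right)$, and both one-sided limits $\lim_{w\to0^+}\mathcal{F}(\tau\pm iw)$ exist. 4. $\mathcal{F}$ has at most polynomial growth towards $i\infty$: there is $m\ge 0$ with $\mathcal{F}(\tau)=O(y^m)$ as $y\to\infty$, uniformly in $x$. -/

import Mathlib

open scoped UpperHalfPlane ModularForm MatrixGroups Topology Real

noncomputable section

/-! ### Integral binary quadratic forms -/

/-- The integral binary quadratic form `[a, b, c](X, Y) = a X ^ 2 + b X Y + c Y ^ 2`. -/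
@[ext]
structure IntBinForm where
  a : ℤ
  b : ℤ
  c : ℤ

namespace IntBinForm

/-- The discriminant `b ^ 2 - 4 a c`. -/
def disc (Q : IntBinForm) : ℤ := Q.b ^ 2 - 4 * Q.a * Q.c

/-- The value `Q(X, Y)`, in any commutative ring. -/
def eval {R : Type*} [CommRing R] (Q : IntBinForm) (X Y : R) : R :=
  (Q.a : R) * X ^ 2 + (Q.b : R) * X * Y + (Q.c : R) * Y ^ 2

/-- The action of `SL(2, ℤ)` by substitution, `(Q ∘ γ)(X, Y) = Q(α X + β Y, δ X + ε Y)` for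
`γ = !![α, β; δ, ε]`. -/
def comp (Q : IntBinForm) (γ : SL(2, ℤ)) : IntBinForm where
  a := Q.a * (γ 0 0) ^ 2 + Q.b * γ 0 0 * γ 1 0 + Q.c * (γ 1 0) ^ 2
  b := 2 * Q.a * γ 0 0 * γ 0 1 + Q.b * (γ 0 0 * γ 1 1 + γ 0 1 * γ 1 0) + 2 * Q.c * γ 1 0 * γ 1 1
  c := Q.a * (γ 0 1) ^ 2 + Q.b * γ 0 1 * γ 1 1 + Q.c * (γ 1 1) ^ 2

theorem eval_comp {R : Type*} [CommRing R] (Q : IntBinForm) (γ : SL(2, ℤ)) (X Y : R) :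
    (Q.comp γ).eval X Y =
      Q.eval ((γ 0 0 : R) * X + (γ 0 1 : R) * Y) ((γ 1 0 : R) * X + (γ 1 1 : R) * Y) := by
  simp only [eval, comp]
  push_cast
  ring

/-- The set `𝒬_D` of integral binary quadratic forms of discriminant `D`. -/
def ofDisc (D : ℤ) : Set IntBinForm := {Q | Q.disc = D}

/-- The narrow equivalence class of `Q`: all forms that are `SL(2, ℤ)`-equivalent to `Q`. -/
def narrowClass (Q : IntBinForm) : Set IntBinForm := {Q' | ∃ γ : SL(2, ℤ), Q' = Q.comp γ}

/-- The real number `a |τ| ^ 2 + b Re τ + c`. -/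
def geodesicFun (Q : IntBinForm) (τ : ℍ) : ℝ :=
  (Q.a : ℝ) * ‖(τ : ℂ)‖ ^ 2 + (Q.b : ℝ) * τ.re + (Q.c : ℝ)

/-- The geodesic `S_Q = {τ ∈ ℍ | a |τ| ^ 2 + b Re τ + c = 0}`. -/
def geodesic (Q : IntBinForm) : Set ℍ := {τ | Q.geodesicFun τ = 0}

end IntBinForm

/-- The exceptional set `E_D`, the union of the geodesics `S_Q` over all `Q` of discriminant `D`. -/
def exceptionalSet (D : ℤ) : Set ℍ := ⋃ Q ∈ IntBinForm.ofDisc D, Q.geodesic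

/-! ### The series -/

/-- The incomplete beta function `β(v; s, w) = ∫_0^v u ^ (s - 1) (1 - u) ^ (w - 1) du`
(used for `0 ≤ v ≤ 1` and `s, w > 0`). -/
def incompleteBeta (v s w : ℝ) : ℝ := ∫ u in (0 : ℝ)..v, u ^ (s - 1) * (1 - u) ^ (w - 1)

/-- `ψ(v) = β(v; k - 1/2, 1/2) / 2`. -/
def psiBeta (k : ℕ) (v : ℝ) : ℝ := 1 / 2 * incompleteBeta v ((k : ℝ) - 1 / 2) (1 / 2)

/-- The summand
`sgn(a |τ| ^ 2 + b x + c) Q(τ, 1) ^ (k - 1) ψ(D y ^ 2 / |Q(τ, 1)| ^ 2)`, with `sgn 0 = 0`. -/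
def maassTerm (k : ℕ) (D : ℤ) (Q : IntBinForm) (τ : ℍ) : ℂ :=
  (Real.sign (Q.geodesicFun τ) : ℂ) * Q.eval (τ : ℂ) 1 ^ (k - 1) *
    (psiBeta k ((D : ℝ) * τ.im ^ 2 / ‖Q.eval (τ : ℂ) 1‖ ^ 2) : ℂ)

/-- The constant `D ^ (1/2 - k) / (binom (2k - 2) (k - 1) * π)`. -/
def maassConst (k : ℕ) (D : ℤ) : ℝ :=
  (D : ℝ) ^ ((1 : ℝ) / 2 - (k : ℝ)) / (((2 * k - 2).choose (k - 1) : ℝ) * π)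

/-- The function `ℱ_{1-k,D}`. -/
def maassF (k : ℕ) (D : ℤ) (τ : ℍ) : ℂ :=
  (maassConst k D : ℂ) * ∑' Q : IntBinForm.ofDisc D, maassTerm k D Q τ

/-- The function `ℱ_{1-k,D,𝒜}` attached to a set `𝒜` of forms of discriminant `D`. -/
def maassFNarrow (k : ℕ) (D : ℤ) (A : Set IntBinForm) (τ : ℍ) : ℂ :=
  (-1) ^ k * (maassConst k D : ℂ) * ∑' Q : A, maassTerm k D Q τ

/-- Compact convergence on `ℍ` of the series `∑ i, g i`: it converges absolutely at every point,
and the net of its finite partial sums converges uniformly on every compact set. -/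
def ConvergesCompactly {ι : Type*} (g : ι → ℍ → ℂ) : Prop :=
  (∀ τ : ℍ, Summable fun i => ‖g i τ‖) ∧
    ∀ K : Set ℍ, IsCompact K → HasSumUniformlyOn g (fun τ => ∑' i, g i τ) K

/-! ### Locally harmonic Maass forms -/

/-- The partial derivative in `x` of a function of `z = x + i y`. -/
def partialX (f : ℂ → ℂ) (z : ℂ) : ℂ := fderiv ℝ f z 1

/-- The partial derivative in `y` of a function of `z = x + i y`. -/
def partialY (f : ℂ → ℂ) (z : ℂ) : ℂ := fderiv ℝ f z Complex.I

/-- The weight `κ` hyperbolic Laplacian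
`Δ_κ = -y ^ 2 (∂²/∂x² + ∂²/∂y²) + i κ y (∂/∂x + i ∂/∂y)`. -/
def hypLaplacian (κ : ℤ) (f : ℂ → ℂ) (z : ℂ) : ℂ :=
  -(z.im : ℂ) ^ 2 * (partialX (partialX f) z + partialY (partialY f) z) +
    Complex.I * (κ : ℂ) * (z.im : ℂ) * (partialX f z + Complex.I * partialY f z)

/-- A function on `ℍ` seen as a function on `ℂ`; only its values at points of the upper
half-plane are ever used, where it agrees with `F`. -/
def toPlane (F : ℍ → ℂ) (z : ℂ) : ℂ := F (UpperHalfPlane.ofComplex z)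

theorem toPlane_coe (F : ℍ → ℂ) (τ : ℍ) : toPlane F (τ : ℂ) = F τ := by
  simp [toPlane]

/-- Locally harmonic Maass forms of weight `κ` for `SL(2, ℤ)` with exceptional set `E`. -/
structure IsLocallyHarmonicMaassForm (κ : ℤ) (E : Set ℍ) (F : ℍ → ℂ) : Prop where
  /-- Modularity of weight `κ`. -/
  slash_eq : ∀ γ : SL(2, ℤ), F ∣[κ] γ = F
  /-- Off `E`, the function is locally real analytic and annihilated by `Δ_κ`. -/
  locally_harmonic : ∀ τ : ℍ, τ ∉ E → ∃ N : Set ℂ, IsOpen N ∧ (τ : ℂ) ∈ N ∧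
    (∀ z ∈ N, 0 < z.im) ∧ AnalyticOnNhd ℝ (toPlane F) N ∧
    ∀ z ∈ N, hypLaplacian κ (toPlane F) z = 0
  /-- On `E`, `F τ = (1/2) lim_{w → 0+} (F (τ + i w) + F (τ - i w))`. -/
  average : ∀ τ ∈ E, Filter.Tendsto
    (fun w : ℝ => (1 / 2 : ℂ) * (toPlane F ((τ : ℂ) + Complex.I * (w : ℂ)) +
      toPlane F ((τ : ℂ) - Complex.I * (w : ℂ)))) (𝓝[>] 0) (𝓝 (F τ))
  /-- At most polynomial growth towards `i∞`. -/
  growth : ∃ m : ℕ, F =O[UpperHalfPlane.atImInfty] fun τ : ℍ => τ.im ^ m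

/-- At every point of `E` both one-sided limits of `F` along the vertical direction exist. -/
def HasOneSidedLimits (E : Set ℍ) (F : ℍ → ℂ) : Prop :=
  ∀ τ ∈ E, ∃ L₁ L₂ : ℂ,
    Filter.Tendsto (fun w : ℝ => toPlane F ((τ : ℂ) + Complex.I * (w : ℂ))) (𝓝[>] 0) (𝓝 L₁) ∧
    Filter.Tendsto (fun w : ℝ => toPlane F ((τ : ℂ) - Complex.I * (w : ℂ))) (𝓝[>] 0) (𝓝 L₂)

end

/-! Everything rests on the identity `|Q(z,1)|² = g² + D y²`, where `g = a|z|² + bx + c`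
(`norm_eval_sq`). It puts the argument of `ψ` in `(0, 1]`, and `ψ(w²) ≤ w^(2k-1)` then bounds each
term by `(√D y)^(k+1) / |Q(z,1)|²`. On a set with bounded `x` and with `y` bounded below, `1 + |b| ≪
|Q(z,1)|`. Since `a` divides the nonzero number `b² - D`, the divisor bound leaves `≪ (1 +
|b|)^(1/2)` forms for each `b`, so `∑ (1 + |b|)⁻²` over forms converges. This one majorant gives
compact convergence, the vertical limits (by dominated convergence) and the growth.

Off `S_Q`, the operator `∂x + i∂y` sends the term of `Q` to `y^(2k-2)` times the conjugate of the
holomorphic function `-i (√D)^(2k-1) / Q(z,1)^k` (`cauchyRiemannOp_planeTerm`): the derivative of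
`ψ` has `|g|` in its denominator, and the sign in the definition turns the factor `g` into `|g|`.
Near a point outside `E_D` no geodesic passes, and `analyticOnNhd_tsum_of_cauchyRiemannOp_eq`
carries both this equation and real analyticity over to the sum without differentiating the series
twice. The Laplacian factors through `∂x + i∂y` and kills every analytic solution of such an
equation.

Modularity is a permutation of the forms by `Q ↦ Q ∘ γ`. At a point of `E_D` the two vertical limits
of each sign average to the sign itself, which is `0` on `S_Q`. -/

/-! ### Divisor bound and summability over forms. -/

/-- Compare prime by prime: `(e+1)⁴ ≤ p^e` if `p ≥ 16`, while each smaller prime costs at most a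
factor 256, and fewer than 16 primes are that small. The fourth power is enough to make the number
of divisors of `b² - D` grow like `|b|^(1/2)` at most. -/
theorem Nat.card_divisors_pow_four_le {n : ℕ} (hn : n ≠ 0) :
    n.divisors.card ^ 4 ≤ 256 ^ 16 * n := by
  have hsmall : ∀ e : ℕ, (e + 1) ^ 4 ≤ 256 * 2 ^ e := by
    intro e
    by_cases he : e < 6
    · interval_cases e <;> norm_num
    · push Not at he
      induction e, he using Nat.le_induction with
      | base => norm_num
      | succ m hm ih =>
        have h : (m + 1 + 1) ^ 4 ≤ 2 * (m + 1) ^ 4 := by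
          obtain ⟨t, rfl⟩ := Nat.exists_eq_add_of_le hm
          ring_nf
          nlinarith [Nat.zero_le t, Nat.zero_le (t ^ 2), Nat.zero_le (t ^ 3), Nat.zero_le (t ^ 4)]
        rw [pow_succ 2 m]; linarith
  have hlarge : ∀ e p : ℕ, 16 ≤ p → (e + 1) ^ 4 ≤ p ^ e := by
    intro e p hp
    calc (e + 1) ^ 4 ≤ (2 ^ e) ^ 4 := Nat.pow_le_pow_left (Nat.lt_two_pow_self) 4
      _ = 16 ^ e := by rw [← pow_mul, mul_comm, pow_mul]; norm_num
      _ ≤ p ^ e := Nat.pow_le_pow_left hp e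
  have hprod : ∏ p ∈ n.primeFactors, p ^ n.factorization p = n := by
    simpa [Finsupp.prod] using Nat.prod_factorization_pow_eq_self hn
  have hconst : ∏ p ∈ n.primeFactors, (if p < 16 then 256 else 1) ≤ 256 ^ 16 := by
    rw [Finset.prod_ite, Finset.prod_const, Finset.prod_const_one, mul_one]
    refine Nat.pow_le_pow_right (by norm_num) ?_
    calc _ ≤ (Finset.range 16).card := Finset.card_le_card fun p hp => by simp at hp ⊢; exact hp.2
      _ = 16 := by simp
  rw [Nat.card_divisors hn, ← Finset.prod_pow]
  calc ∏ p ∈ n.primeFactors, (n.factorization p + 1) ^ 4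
      ≤ ∏ p ∈ n.primeFactors, ((if p < 16 then 256 else 1) * p ^ n.factorization p) := by
        refine Finset.prod_le_prod' fun p hp => ?_
        split_ifs with h
        · exact (hsmall _).trans
            (Nat.mul_le_mul_left _ (Nat.pow_le_pow_left (Nat.prime_of_mem_primeFactors hp).two_le _))
        · simpa using hlarge _ p (not_lt.mp h)
    _ = (∏ p ∈ n.primeFactors, (if p < 16 then 256 else 1)) * n := by
        rw [Finset.prod_mul_distrib, hprod]
    _ ≤ _ := Nat.mul_le_mul_right _ hconst

theorem summable_int_one_add_abs_rpow {s : ℝ} (hs : s < -1) :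
    Summable fun b : ℤ => (1 + |(b : ℝ)|) ^ s := by
  have h : Summable fun n : ℕ => (1 + (n : ℝ)) ^ s := by
    have := (summable_nat_add_iff 1).2 (Real.summable_nat_rpow.2 hs)
    refine this.congr fun n => ?_
    push_cast; rw [add_comm]
  refine Summable.of_nat_of_neg ?_ ?_ <;> simpa using h

/-- The fibre over `b` contributes at most `C (1+|b|)^(1/2-2)`, and `-3/2 < -1`. -/
theorem summable_sigma_one_div_sq {S : ℤ → Finset ℤ} {C : ℝ}
    (hS : ∀ b, ((S b).card : ℝ) ≤ C * (1 + |(b : ℝ)|) ^ (1 / 2 : ℝ)) :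
    Summable fun x : (Σ b : ℤ, S b) => 1 / (1 + |(x.1 : ℝ)|) ^ 2 := by
  rw [summable_sigma_of_nonneg (fun x => by positivity)]
  refine ⟨fun b => Summable.of_finite, ?_⟩
  refine Summable.of_nonneg_of_le (fun b => tsum_nonneg fun _ => by positivity) (fun b => ?_)
    ((summable_int_one_add_abs_rpow (s := -3 / 2) (by norm_num)).mul_left C)
  have hb : 0 < 1 + |(b : ℝ)| := by positivity
  have hcount : ∑' _ : S b, 1 / (1 + |(b : ℝ)|) ^ 2 = (S b).card * (1 / (1 + |(b : ℝ)|) ^ 2) := by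
    rw [tsum_fintype, Finset.sum_const, nsmul_eq_mul, Finset.card_univ, Fintype.card_coe]
  calc ∑' _ : S b, 1 / (1 + |(b : ℝ)|) ^ 2
      ≤ C * (1 + |(b : ℝ)|) ^ (1 / 2 : ℝ) * (1 / (1 + |(b : ℝ)|) ^ 2) := by
        rw [hcount]; gcongr; exact hS b
    _ = _ := by
      rw [mul_assoc]
      congr 1
      rw [one_div ((1 + |(b : ℝ)|) ^ 2), ← Real.rpow_natCast, ← Real.rpow_neg hb.le,
        ← Real.rpow_add hb]
      norm_num

namespace IntBinForm

theorem ne_zero_of_not_isSquare {D : ℤ} (hsq : ¬ IsSquare D) {Q : IntBinForm} (hQ : Q ∈ ofDisc D) :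
    Q.a ≠ 0 := by
  intro ha
  apply hsq
  have : Q.disc = D := hQ
  rw [← this, disc, ha]
  exact ⟨Q.b, by ring⟩

theorem card_divisors_sq_sub_le {D b : ℤ} (hne : b ^ 2 - D ≠ 0) :
    ((b ^ 2 - D).natAbs.divisors.card : ℝ) ≤
      (256 ^ 16 * (1 + |(D : ℝ)|)) ^ (1 / 4 : ℝ) * (1 + |(b : ℝ)|) ^ (1 / 2 : ℝ) := by
  have hb : 0 ≤ 1 + |(b : ℝ)| := by positivity
  have hcard : (((b ^ 2 - D).natAbs.divisors.card : ℝ)) ^ 4 ≤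
      256 ^ 16 * (((b ^ 2 - D).natAbs : ℕ) : ℝ) := by
    exact_mod_cast Nat.card_divisors_pow_four_le (Int.natAbs_ne_zero.2 hne)
  rw [Nat.cast_natAbs] at hcard
  push_cast at hcard
  have habs : |(b : ℝ) ^ 2 - D| ≤ (1 + |(D : ℝ)|) * (1 + |(b : ℝ)|) ^ 2 := by
    have := abs_sub ((b : ℝ) ^ 2) D
    rw [abs_pow] at this
    nlinarith [abs_nonneg (b : ℝ), abs_nonneg (D : ℝ),
      mul_nonneg (abs_nonneg (b : ℝ)) (abs_nonneg (D : ℝ)),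
      mul_nonneg (sq_nonneg |(b : ℝ)|) (abs_nonneg (D : ℝ))]
  have hsqrt : ((1 + |(b : ℝ)|) ^ 2) ^ (1 / 4 : ℝ) = (1 + |(b : ℝ)|) ^ (1 / 2 : ℝ) := by
    rw [← Real.rpow_natCast, ← Real.rpow_mul hb]; norm_num
  rw [← hsqrt, ← Real.mul_rpow (by positivity) (by positivity), mul_assoc]
  refine le_trans (le_of_eq ?_) (Real.rpow_le_rpow (by positivity)
    (hcard.trans (mul_le_mul_of_nonneg_left habs (by positivity))) (by norm_num))
  rw [← Real.rpow_natCast, ← Real.rpow_mul (by positivity)]; norm_num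

/-- From `4ac = b² - D ≠ 0`, the coefficient `a` is plus or minus a divisor of `|b² - D|`. As `a ≠
0`, the pair `(b, a)` determines `c`, so forms inject into the pairs counted by the divisor bound.
-/
theorem summable_one_div_sq {D : ℤ} (hsq : ¬ IsSquare D) :
    Summable fun Q : ofDisc D => 1 / (1 + |(Q.1.b : ℝ)|) ^ 2 := by
  have hne : ∀ b : ℤ, b ^ 2 - D ≠ 0 := fun b h => hsq ⟨b, by linarith [sq b]⟩
  let S : ℤ → Finset ℤ := fun b =>
    (b ^ 2 - D).natAbs.divisors.image (Nat.cast : ℕ → ℤ) ∪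
      (b ^ 2 - D).natAbs.divisors.image (fun d : ℕ => -(d : ℤ))
  have hS : ∀ b, ((S b).card : ℝ) ≤
      (2 * (256 ^ 16 * (1 + |(D : ℝ)|)) ^ (1 / 4 : ℝ)) * (1 + |(b : ℝ)|) ^ (1 / 2 : ℝ) := by
    intro b
    have h1 : (S b).card ≤ 2 * (b ^ 2 - D).natAbs.divisors.card := by
      refine (Finset.card_union_le _ _).trans ?_
      rw [two_mul]
      exact add_le_add Finset.card_image_le Finset.card_image_le
    have h2 : ((S b).card : ℝ) ≤ 2 * ((b ^ 2 - D).natAbs.divisors.card : ℝ) := by exact_mod_cast h1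
    rw [mul_assoc]
    exact h2.trans (mul_le_mul_of_nonneg_left (card_divisors_sq_sub_le (hne b)) (by norm_num))
  have hmem : ∀ Q : ofDisc D, Q.1.a ∈ S Q.1.b := by
    rintro ⟨Q, hQ⟩
    have hd : Q.a.natAbs ∈ (Q.b ^ 2 - D).natAbs.divisors := by
      rw [Nat.mem_divisors]
      refine ⟨Int.natAbs_dvd_natAbs.2 ⟨4 * Q.c, ?_⟩, Int.natAbs_ne_zero.2 (hne _)⟩
      have hQ' : Q.b ^ 2 - 4 * Q.a * Q.c = D := hQ
      linarith
    refine Finset.mem_union.2 ?_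
    rcases Int.natAbs_eq Q.a with h | h
    · exact Or.inl (Finset.mem_image.2 ⟨_, hd, h.symm⟩)
    · exact Or.inr (Finset.mem_image.2 ⟨_, hd, h.symm⟩)
  refine (summable_sigma_one_div_sq hS).comp_injective
    (i := fun Q : ofDisc D => (⟨Q.1.b, Q.1.a, hmem Q⟩ : Σ b : ℤ, S b)) ?_
  rintro ⟨Q, hQ⟩ ⟨Q', hQ'⟩ h
  have hb : Q.b = Q'.b := congrArg Sigma.fst h
  have ha : Q.a = Q'.a := congrArg (fun x : (Σ b : ℤ, S b) => (x.2 : ℤ)) h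
  have hc : Q.c = Q'.c := by
    have h1 : Q.disc = Q'.disc := Eq.trans hQ (Eq.symm hQ')
    rw [disc, disc, hb, ha] at h1
    exact mul_left_cancel₀ (ne_zero_of_not_isSquare hsq hQ') (by linarith)
  exact Subtype.ext (IntBinForm.ext ha hb hc)

end IntBinForm

/-! ### The operator `∂x + i∂y` and series of solutions of `(∂x + i∂y) g = yⁿ conj f`. -/

noncomputable section

open ComplexConjugate Metric

/-- The Cauchy-Riemann operator `∂/∂x + i ∂/∂y`. -/
def cauchyRiemannOp (f : ℂ → ℂ) (z : ℂ) : ℂ := partialX f z + Complex.I * partialY f z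

theorem HasFDerivAt.cauchyRiemannOp_eq {f : ℂ → ℂ} {f' : ℂ →L[ℝ] ℂ} {z : ℂ}
    (h : HasFDerivAt f f' z) : cauchyRiemannOp f z = f' 1 + Complex.I * f' Complex.I := by
  rw [cauchyRiemannOp, partialX, partialY, h.fderiv]

theorem Filter.EventuallyEq.cauchyRiemannOp_eq {f g : ℂ → ℂ} {z : ℂ} (h : f =ᶠ[𝓝 z] g) :
    cauchyRiemannOp f z = cauchyRiemannOp g z := by
  rw [cauchyRiemannOp, partialX, partialY, h.fderiv_eq]; rfl

theorem cauchyRiemannOp_add {f g : ℂ → ℂ} {z : ℂ} (hf : DifferentiableAt ℝ f z)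
    (hg : DifferentiableAt ℝ g z) :
    cauchyRiemannOp (fun w => f w + g w) z = cauchyRiemannOp f z + cauchyRiemannOp g z := by
  rw [(hf.hasFDerivAt.fun_add hg.hasFDerivAt).cauchyRiemannOp_eq, hf.hasFDerivAt.cauchyRiemannOp_eq,
    hg.hasFDerivAt.cauchyRiemannOp_eq]
  simp only [_root_.add_apply]
  ring

theorem cauchyRiemannOp_sub {f g : ℂ → ℂ} {z : ℂ} (hf : DifferentiableAt ℝ f z)
    (hg : DifferentiableAt ℝ g z) :
    cauchyRiemannOp (fun w => f w - g w) z = cauchyRiemannOp f z - cauchyRiemannOp g z := by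
  rw [(hf.hasFDerivAt.fun_sub hg.hasFDerivAt).cauchyRiemannOp_eq, hf.hasFDerivAt.cauchyRiemannOp_eq,
    hg.hasFDerivAt.cauchyRiemannOp_eq]
  simp only [_root_.sub_apply]
  ring

theorem cauchyRiemannOp_of_differentiableAt {f : ℂ → ℂ} {z : ℂ} (hf : DifferentiableAt ℂ f z) :
    cauchyRiemannOp f z = 0 := by
  rw [(hf.hasDerivAt.hasFDerivAt.restrictScalars ℝ).cauchyRiemannOp_eq]
  simp [← mul_assoc]

theorem differentiableAt_of_cauchyRiemannOp_eq_zero {f : ℂ → ℂ} {z : ℂ}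
    (hf : DifferentiableAt ℝ f z) (h : cauchyRiemannOp f z = 0) : DifferentiableAt ℂ f z := by
  refine differentiableAt_complex_iff_differentiableAt_real.2 ⟨hf, ?_⟩
  rw [cauchyRiemannOp, partialX, partialY] at h
  linear_combination (exp := 1) (-Complex.I) * h + (fderiv ℝ f z Complex.I) * Complex.I_mul_I

theorem cauchyRiemannOp_mul {f g : ℂ → ℂ} {z : ℂ} (hf : DifferentiableAt ℂ f z)
    (hg : DifferentiableAt ℝ g z) :
    cauchyRiemannOp (fun w => f w * g w) z = f z * cauchyRiemannOp g z := by
  have h := cauchyRiemannOp_of_differentiableAt hf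
  have hf' := (hf.hasDerivAt.hasFDerivAt.restrictScalars ℝ)
  rw [hf'.cauchyRiemannOp_eq] at h
  rw [(hf'.fun_mul hg.hasFDerivAt).cauchyRiemannOp_eq, hg.hasFDerivAt.cauchyRiemannOp_eq]
  simp only [_root_.add_apply, _root_.smul_apply, smul_eq_mul]
  linear_combination g z * h

theorem cauchyRiemannOp_ofReal_comp {φ : ℝ → ℝ} {v : ℂ → ℝ} {z : ℂ} {φ' : ℝ}
    (hφ : HasDerivAt φ φ' (v z)) (hv : DifferentiableAt ℝ v z) :
    DifferentiableAt ℝ (fun w => (φ (v w) : ℂ)) z ∧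
    cauchyRiemannOp (fun w => (φ (v w) : ℂ)) z = φ' * cauchyRiemannOp (fun w => (v w : ℂ)) z := by
  have h1 := (Complex.ofRealCLM.hasFDerivAt (x := v z)).comp z hv.hasFDerivAt
  have h2 := (Complex.ofRealCLM.hasFDerivAt (x := φ (v z))).comp z
    (hφ.hasFDerivAt.comp z hv.hasFDerivAt)
  refine ⟨h2.differentiableAt, ?_⟩
  have e1 := HasFDerivAt.cauchyRiemannOp_eq (f := fun w => (v w : ℂ)) h1
  have e2 := HasFDerivAt.cauchyRiemannOp_eq (f := fun w => (φ (v w) : ℂ)) h2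
  rw [e1, e2]
  simp
  ring

theorem hasFDerivAt_im_pow_mul_conj (n : ℕ) {P : ℂ → ℂ} {z P' : ℂ} (hP : HasDerivAt P P' z) :
    ∃ f' : ℂ →L[ℝ] ℂ, HasFDerivAt (fun w : ℂ => (w.im : ℂ) ^ n * conj (P w)) f' z ∧
      ∀ h : ℂ, f' h = n * (z.im : ℂ) ^ (n - 1) * h.im * conj (P z) +
        (z.im : ℂ) ^ n * conj (P' * h) := by
  have h1 : HasFDerivAt (fun w : ℂ => (w.im : ℂ))
      (Complex.ofRealCLM.comp Complex.imCLM) z :=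
    (Complex.ofRealCLM.comp Complex.imCLM).hasFDerivAt
  have h2 := h1.pow n
  have h3 := (Complex.conjCLE.toContinuousLinearMap.hasFDerivAt (x := P z)).comp z
    (hP.hasFDerivAt.restrictScalars ℝ)
  refine ⟨_, h2.mul h3, fun h => ?_⟩
  simp
  ring

theorem cauchyRiemannOp_im_pow_mul_conj (n : ℕ) {P : ℂ → ℂ} {z P' : ℂ} (hP : HasDerivAt P P' z) :
    cauchyRiemannOp (fun w : ℂ => (w.im : ℂ) ^ n * conj (P w)) z =
      n * (z.im : ℂ) ^ (n - 1) * Complex.I * conj (P z) + (z.im : ℂ) ^ n * (2 * conj P') := by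
  obtain ⟨f', hf', h⟩ := hasFDerivAt_im_pow_mul_conj n hP
  rw [hf'.cauchyRiemannOp_eq, h, h]
  simp
  linear_combination -(z.im : ℂ) ^ n * conj P' * Complex.I_mul_I

theorem AnalyticAt.im_pow_mul_conj (n : ℕ) {P : ℂ → ℂ} {z : ℂ} (hP : AnalyticAt ℂ P z) :
    AnalyticAt ℝ (fun w : ℂ => (w.im : ℂ) ^ n * conj (P w)) z := by
  have h1 : AnalyticAt ℝ (fun w : ℂ => (w.im : ℂ)) z :=
    (Complex.ofRealCLM.comp Complex.imCLM).analyticAt z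
  have h2 : AnalyticAt ℝ (fun w : ℂ => conj (P w)) z :=
    (Complex.conjCLE.toContinuousLinearMap.analyticAt (P z)).comp hP.restrictScalars
  exact (h1.pow n).mul h2

/-- Primitives vanishing at the centre inherit the majorant up to the factor `r`, so normal
convergence survives integration. -/
theorem exists_primitive_norm_le {f : ℂ → ℂ} {c : ℂ} {r v : ℝ} (hr : 0 < r)
    (hf : DifferentiableOn ℂ f (ball c r)) (hv : ∀ z ∈ ball c r, ‖f z‖ ≤ v) :
    ∃ P : ℂ → ℂ, (∀ z ∈ ball c r, HasDerivAt P (f z) z) ∧ ∀ z ∈ ball c r, ‖P z‖ ≤ r * v := by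
  obtain ⟨P, hPc, hP⟩ := (hf.isExactOn_ball).with_val_at c 0
  refine ⟨P, hP, fun z hz => ?_⟩
  have := (convex_ball c r).norm_image_sub_le_of_norm_hasDerivWithin_le
    (fun w hw => (hP w hw).hasDerivWithinAt) hv (mem_ball_self hr) hz
  rw [hPc, sub_zero] at this
  have hv0 : 0 ≤ v := (norm_nonneg _).trans (hv c (mem_ball_self hr))
  calc ‖P z‖ ≤ v * ‖z - c‖ := this
    _ ≤ v * r := by gcongr; exact (mem_ball_iff_norm.1 hz).le
    _ = r * v := mul_comm _ _

theorem hasDerivAt_tsum_of_norm_le {ι : Type*} {U : Set ℂ} (hU : IsOpen U) {P p : ι → ℂ → ℂ}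
    {v : ι → ℝ} (hv : Summable v) (hP : ∀ i, ∀ z ∈ U, HasDerivAt (P i) (p i z) z)
    (hPv : ∀ i, ∀ z ∈ U, ‖P i z‖ ≤ v i) {z : ℂ} (hz : z ∈ U) :
    HasDerivAt (fun w => ∑' i, P i w) (∑' i, p i z) z := by
  have hd : ∀ i, DifferentiableOn ℂ (P i) U :=
    fun i w hw => (hP i w hw).differentiableAt.differentiableWithinAt
  have h1 := (Complex.differentiableOn_tsum_of_summable_norm hv hd hU hPv).differentiableAt
    (hU.mem_nhds hz)
  have h2 := (Complex.hasSum_deriv_of_summable_norm hv hd hU hPv hz).tsum_eq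
  rw [tsum_congr fun i => (hP i z hz).deriv] at h2
  rw [h2]
  exact h1.hasDerivAt

/-- If `(∂/∂x + i ∂/∂y) gᵢ = y ^ n conj fᵢ` on a ball with `fᵢ` holomorphic, and both series converge
normally, then `∑ gᵢ` is real analytic and `(∂/∂x + i ∂/∂y) ∑ gᵢ = y ^ n conj (∑ fᵢ)`. -/
theorem analyticOnNhd_tsum_of_cauchyRiemannOp_eq {ι : Type*} {c : ℂ} {r : ℝ} (hr : 0 < r) (n : ℕ)
    {g f : ι → ℂ → ℂ} {u v : ι → ℝ} (hu : Summable u) (hv : Summable v)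
    (hg : ∀ i, ∀ z ∈ ball c r, DifferentiableAt ℝ (g i) z)
    (hf : ∀ i, DifferentiableOn ℂ (f i) (ball c r))
    (hgf : ∀ i, ∀ z ∈ ball c r, cauchyRiemannOp (g i) z = (z.im : ℂ) ^ n * conj (f i z))
    (hgu : ∀ i, ∀ z ∈ ball c r, ‖g i z‖ ≤ u i) (hfv : ∀ i, ∀ z ∈ ball c r, ‖f i z‖ ≤ v i) :
    AnalyticOnNhd ℝ (fun z => ∑' i, g i z) (ball c r) ∧
      ∀ z ∈ ball c r, cauchyRiemannOp (fun z => ∑' i, g i z) z =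
        (z.im : ℂ) ^ n * conj (∑' i, f i z) := by
  induction n using Nat.strong_induction_on generalizing g f u v with
  | _ n ih =>
  -- The factor `1/2` compensates `(∂x + i∂y) conj P = 2 conj P'`.
  have hprim : ∀ i, ∃ P : ℂ → ℂ, (∀ z ∈ ball c r, HasDerivAt P (f i z / 2) z) ∧
      ∀ z ∈ ball c r, ‖P z‖ ≤ r * v i := fun i =>
    exists_primitive_norm_le hr ((hf i).div_const 2) fun z hz => by
      rw [norm_div, Complex.norm_two]
      have := hfv i z hz
      linarith [norm_nonneg (f i z)]
  choose P hP hPv using hprim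
  have hvr : Summable fun i => r * v i := hv.mul_left r
  have hPsum : ∀ z ∈ ball c r, HasDerivAt (fun w => ∑' i, P i w) (∑' i, f i z / 2) z :=
    fun z hz => hasDerivAt_tsum_of_norm_le isOpen_ball hvr hP hPv hz
  have hPdiff : DifferentiableOn ℂ (fun w => ∑' i, P i w) (ball c r) :=
    fun z hz => (hPsum z hz).differentiableAt.differentiableWithinAt
  have hQdiff : ∀ i, ∀ z ∈ ball c r,
      DifferentiableAt ℝ (fun w : ℂ => (w.im : ℂ) ^ n * conj (P i w)) z := fun i z hz =>
    (hasFDerivAt_im_pow_mul_conj n (hP i z hz)).choose_spec.1.differentiableAt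
  have him : ∀ z ∈ ball c r, ‖(z.im : ℂ) ^ n‖ ≤ (‖c‖ + r) ^ n := fun z hz => by
    rw [norm_pow, Complex.norm_real]
    have h1 : ‖z‖ ≤ ‖c‖ + r := by
      have := norm_sub_norm_le z c
      linarith [mem_ball_iff_norm.1 hz]
    exact pow_le_pow_left₀ (norm_nonneg _) ((Complex.abs_im_le_norm z).trans h1) n
  -- Subtracting `yⁿ conj P` cancels the right-hand side and leaves `-i n y^(n-1) conj P`, an
  -- equation of the same shape with exponent `n - 1`.
  set h : ι → ℂ → ℂ := fun i z => g i z - (z.im : ℂ) ^ n * conj (P i z) with hh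
  have hhu : ∀ i, ∀ z ∈ ball c r, ‖h i z‖ ≤ u i + (‖c‖ + r) ^ n * (r * v i) := fun i z hz => by
    refine (norm_sub_le _ _).trans (add_le_add (hgu i z hz) ?_)
    rw [norm_mul, RCLike.norm_conj]
    exact mul_le_mul (him z hz) (hPv i z hz) (norm_nonneg _) (by positivity)
  have hhs : Summable fun i => u i + (‖c‖ + r) ^ n * (r * v i) := hu.add (hvr.mul_left _)
  have hhd : ∀ i, ∀ z ∈ ball c r, DifferentiableAt ℝ (h i) z :=
    fun i z hz => (hg i z hz).sub (hQdiff i z hz)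
  have hhc : ∀ i, ∀ z ∈ ball c r, cauchyRiemannOp (h i) z =
      -(n * (z.im : ℂ) ^ (n - 1) * Complex.I * conj (P i z)) := fun i z hz => by
    rw [hh, cauchyRiemannOp_sub (hg i z hz) (hQdiff i z hz), hgf i z hz,
      cauchyRiemannOp_im_pow_mul_conj n (hP i z hz), map_div₀, map_ofNat]
    ring
  have hsplit : ∀ z ∈ ball c r,
      ∑' i, g i z = ∑' i, h i z + (z.im : ℂ) ^ n * conj (∑' i, P i z) := fun z hz => by
    have s1 : Summable fun i => h i z := Summable.of_norm_bounded hhs fun i => hhu i z hz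
    have s2 : Summable fun i => conj (P i z) :=
      Summable.of_norm_bounded hvr fun i => by rw [RCLike.norm_conj]; exact hPv i z hz
    rw [Complex.conj_tsum, ← tsum_mul_left, ← s1.tsum_add (s2.mul_left _)]
    exact tsum_congr fun i => by simp [hh]
  have hkey : AnalyticOnNhd ℝ (fun z => ∑' i, h i z) (ball c r) ∧
      ∀ z ∈ ball c r, cauchyRiemannOp (fun z => ∑' i, h i z) z =
        -(n * (z.im : ℂ) ^ (n - 1) * Complex.I * conj (∑' i, P i z)) := by
    -- For `n = 0` the remainders satisfy the Cauchy-Riemann equation, so their normally convergent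
    -- sum is holomorphic.
    rcases n with _ | n
    · have hhol : DifferentiableOn ℂ (fun z => ∑' i, h i z) (ball c r) :=
        Complex.differentiableOn_tsum_of_summable_norm hhs
          (fun i z hz => (differentiableAt_of_cauchyRiemannOp_eq_zero (hhd i z hz)
            (by rw [hhc i z hz]; simp)).differentiableWithinAt) isOpen_ball hhu
      refine ⟨fun z hz => (hhol.analyticAt (isOpen_ball.mem_nhds hz)).restrictScalars,
        fun z hz => ?_⟩
      rw [cauchyRiemannOp_of_differentiableAt (hhol.differentiableAt (isOpen_ball.mem_nhds hz))]
      simp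
    · obtain ⟨h1, h2⟩ := ih n (Nat.lt_succ_self n)
        (f := fun i z => ((n : ℂ) + 1) * Complex.I * P i z)
        (v := fun i => ((n : ℝ) + 1) * (r * v i)) hhs (hvr.mul_left _) hhd
        (fun i z hz => ((hP i z hz).differentiableAt.const_mul _).differentiableWithinAt)
        (fun i z hz => by
          rw [hhc i z hz]
          simp
          ring) hhu
        (fun i z hz => by
          have e : ‖(n : ℂ) + 1‖ = n + 1 := by
            rw [← Nat.cast_succ, Complex.norm_natCast, Nat.cast_succ]
          rw [norm_mul, norm_mul, Complex.norm_I, mul_one, e]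
          exact mul_le_mul_of_nonneg_left (hPv i z hz) (by positivity))
      refine ⟨h1, fun z hz => ?_⟩
      rw [h2 z hz, tsum_mul_left]
      simp
      ring
  have hQan : ∀ z ∈ ball c r,
      AnalyticAt ℝ (fun w : ℂ => (w.im : ℂ) ^ n * conj (∑' i, P i w)) z :=
    fun z hz => (hPdiff.analyticAt (isOpen_ball.mem_nhds hz)).im_pow_mul_conj n
  have hev : ∀ z ∈ ball c r, (fun w => ∑' i, g i w) =ᶠ[𝓝 z]
      fun w => ∑' i, h i w + (w.im : ℂ) ^ n * conj (∑' i, P i w) := fun z hz =>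
    Filter.eventuallyEq_of_mem (isOpen_ball.mem_nhds hz) hsplit
  refine ⟨fun z hz => ((hkey.1 z hz).add (hQan z hz)).congr (hev z hz).symm, fun z hz => ?_⟩
  rw [(hev z hz).cauchyRiemannOp_eq, cauchyRiemannOp_add (hkey.1 z hz).differentiableAt
    (hQan z hz).differentiableAt, hkey.2 z hz, cauchyRiemannOp_im_pow_mul_conj n (hPsum z hz),
    tsum_div_const, map_div₀, map_ofNat]
  ring

/-- One has `Δ_κ = (-y²(∂x - i∂y) + iκy)(∂x + i∂y)`. Since `∂x - i∂y` kills `conj f`, it sends `yⁿ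
conj f` to `-i n y^(n-1) conj f`, so the two contributions add up to `i(n + κ) y^(n+1) conj f = 0`.
-/
theorem hypLaplacian_eq_zero_of_cauchyRiemannOp_eq {N : Set ℂ} (hN : IsOpen N) (n : ℕ) {κ : ℤ}
    (hκ : κ = -n) {G f : ℂ → ℂ} (hG : AnalyticOnNhd ℝ G N) (hf : DifferentiableOn ℂ f N)
    (hGf : ∀ z ∈ N, cauchyRiemannOp G z = (z.im : ℂ) ^ n * conj (f z)) {z : ℂ} (hz : z ∈ N) :
    hypLaplacian κ G z = 0 := by
  have hGz := hG z hz
  have hd : DifferentiableAt ℝ (fderiv ℝ G) z := hGz.fderiv.differentiableAt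
  have hX : HasFDerivAt (partialX G) ((fderiv ℝ (fderiv ℝ G) z).flip 1) z := by
    simpa using! hd.hasFDerivAt.clm_apply (hasFDerivAt_const (1 : ℂ) z)
  have hY : HasFDerivAt (partialY G) ((fderiv ℝ (fderiv ℝ G) z).flip Complex.I) z := by
    simpa using! hd.hasFDerivAt.clm_apply (hasFDerivAt_const Complex.I z)
  -- The factorization of the Laplacian needs the mixed partial derivatives to agree.
  have hsymm : fderiv ℝ (fderiv ℝ G) z Complex.I 1 = fderiv ℝ (fderiv ℝ G) z 1 Complex.I :=
    ((hGz.contDiffAt (n := 2)).isSymmSndFDerivAt (by simp)) _ _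
  obtain ⟨f', hf', hf'eq⟩ := hasFDerivAt_im_pow_mul_conj n
    ((hf.differentiableAt (hN.mem_nhds hz)).hasDerivAt)
  have hL := (hX.add (hY.const_mul Complex.I)).congr_of_eventuallyEq
    (f₁ := fun w : ℂ => (w.im : ℂ) ^ n * conj (f w))
    (Filter.eventuallyEq_of_mem (hN.mem_nhds hz) fun w hw => (hGf w hw).symm)
  have hu := hL.unique hf'
  have e1 := congrArg (fun T => T 1) hu
  have e2 := congrArg (fun T => T Complex.I) hu
  simp only [hf'eq] at e1 e2
  have hGz' := hGf z hz
  rw [cauchyRiemannOp] at hGz'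
  rw [hypLaplacian, hGz', partialX, partialY, hX.fderiv, hY.fderiv, hκ]
  simp at e1 e2 ⊢
  have hpow : (n : ℂ) * (z.im : ℂ) ^ (n - 1) * z.im = n * (z.im : ℂ) ^ n := by
    rcases n with _ | n
    · simp
    · simp [pow_succ, mul_assoc]
  linear_combination -(z.im : ℂ) ^ 2 * (e1 - Complex.I * e2 + Complex.I * hsymm) +
    Complex.I * z.im * conj (f z) * hpow - (z.im : ℂ) ^ 2 * ((z.im : ℂ) ^ n * conj (deriv f z) +
    fderiv ℝ (fderiv ℝ G) z Complex.I Complex.I) * Complex.I_mul_I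

/-! ### The incomplete beta function `ψ`. -/

theorem intervalIntegrable_psiBeta {k : ℕ} (hk : 1 < k) :
    IntervalIntegrable (fun u : ℝ => u ^ ((k : ℝ) - 1 / 2 - 1) * (1 - u) ^ ((1 : ℝ) / 2 - 1))
      MeasureTheory.volume 0 1 := by
  have hk' : (2 : ℝ) ≤ k := by exact_mod_cast hk
  have h1 : IntervalIntegrable (fun u : ℝ => (1 - u) ^ ((1 : ℝ) / 2 - 1))
      MeasureTheory.volume 0 1 := by
    have := (intervalIntegral.intervalIntegrable_rpow' (a := 1) (b := 0)
      (r := (1 : ℝ) / 2 - 1) (by norm_num)).comp_sub_left 1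
    simpa using this
  exact h1.continuousOn_mul
    (Real.continuous_rpow_const (by linarith)).continuousOn

theorem continuousOn_psiBeta {k : ℕ} (hk : 1 < k) :
    ContinuousOn (psiBeta k) (Set.Icc 0 1) := by
  have h := intervalIntegral.continuousOn_primitive_interval' (intervalIntegrable_psiBeta hk)
    (Set.left_mem_uIcc)
  rw [Set.uIcc_of_le zero_le_one] at h
  exact continuousOn_const.mul h

/-- On `[0, w²]` the factor `u^(k-3/2)` is at most `w^(2k-3)`, and the integral of `(1-u)^(-1/2)` is
`2(1 - √(1-w²)) ≤ 2w²`. Taking `w²` as argument turns half-integral powers into natural ones. -/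
theorem psiBeta_sq_nonneg_le {k : ℕ} (hk : 1 < k) {w : ℝ} (h0 : 0 ≤ w) (h1 : w ≤ 1) :
    0 ≤ psiBeta k (w ^ 2) ∧ psiBeta k (w ^ 2) ≤ w ^ (2 * k - 1) := by
  have hk' : (2 : ℝ) ≤ k := by exact_mod_cast hk
  have hw2 : w ^ 2 ≤ 1 := pow_le_one₀ h0 h1
  have hsub : Set.uIcc 0 (w ^ 2) ⊆ Set.uIcc 0 1 := by
    rw [Set.uIcc_of_le (sq_nonneg w), Set.uIcc_of_le zero_le_one]
    exact Set.Icc_subset_Icc_right hw2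
  have hint := (intervalIntegrable_psiBeta hk).mono_set hsub
  constructor
  · refine mul_nonneg (by norm_num) (intervalIntegral.integral_nonneg (sq_nonneg w) fun u hu => ?_)
    exact mul_nonneg (Real.rpow_nonneg hu.1 _) (Real.rpow_nonneg (by linarith [hu.2]) _)
  · have hc : IntervalIntegrable (fun u : ℝ => (1 - u) ^ ((1 : ℝ) / 2 - 1))
        MeasureTheory.volume 0 (w ^ 2) := by
      have := (intervalIntegral.intervalIntegrable_rpow' (a := 1) (b := 1 - w ^ 2)
        (r := (1 : ℝ) / 2 - 1) (by norm_num)).comp_sub_left 1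
      simpa using this
    have hle : incompleteBeta (w ^ 2) ((k : ℝ) - 1 / 2) (1 / 2) ≤
        ∫ u in (0 : ℝ)..w ^ 2, (w ^ 2) ^ ((k : ℝ) - 1 / 2 - 1) * (1 - u) ^ ((1 : ℝ) / 2 - 1) := by
      refine intervalIntegral.integral_mono_on (sq_nonneg w) hint (hc.const_mul _) fun u hu => ?_
      exact mul_le_mul_of_nonneg_right (Real.rpow_le_rpow hu.1 hu.2 (by linarith))
        (Real.rpow_nonneg (by linarith [hu.2]) _)
    have hval : ∫ u in (0 : ℝ)..w ^ 2, (1 - u) ^ ((1 : ℝ) / 2 - 1) ≤ 2 * w ^ 2 := by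
      rw [intervalIntegral.integral_comp_sub_left (fun x : ℝ => x ^ ((1 : ℝ) / 2 - 1)),
        integral_rpow (Or.inl (by norm_num))]
      have h2 : 1 - w ^ 2 ≤ (1 - w ^ 2) ^ ((1 : ℝ) / 2) := by
        rw [← Real.sqrt_eq_rpow]
        refine Real.le_sqrt_of_sq_le ?_
        nlinarith [sq_nonneg w]
      norm_num at h2 ⊢
      linarith
    have hpow : (w ^ 2) ^ ((k : ℝ) - 1 / 2 - 1) * w ^ 2 = w ^ (2 * k - 1) := by
      rcases h0.eq_or_lt with rfl | hpos
      · rw [zero_pow (by omega : 2 * k - 1 ≠ 0)]; simp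
      · rw [← Real.rpow_natCast w (2 * k - 1), ← Real.rpow_natCast w 2, ← Real.rpow_mul h0,
          ← Real.rpow_add hpos, Nat.cast_sub (by omega)]
        congr 1
        push_cast
        ring
    rw [intervalIntegral.integral_const_mul] at hle
    have hnn : 0 ≤ (w ^ 2) ^ ((k : ℝ) - 1 / 2 - 1) := Real.rpow_nonneg (sq_nonneg w) _
    rw [psiBeta, ← hpow]
    nlinarith [mul_le_mul_of_nonneg_left hval hnn]

theorem hasDerivAt_psiBeta_sq {k : ℕ} (hk : 1 < k) {w : ℝ} (h0 : 0 < w) (h1 : w < 1) :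
    HasDerivAt (psiBeta k) (w ^ (2 * k - 3) / (2 * √(1 - w ^ 2))) (w ^ 2) := by
  have hw2 : w ^ 2 < 1 := pow_lt_one₀ h0.le h1 two_ne_zero
  have hw0 : 0 < w ^ 2 := by positivity
  have hsub : Set.uIcc 0 (w ^ 2) ⊆ Set.uIcc 0 1 := by
    rw [Set.uIcc_of_le hw0.le, Set.uIcc_of_le zero_le_one]
    exact Set.Icc_subset_Icc_right hw2.le
  have hcont : ContinuousOn
      (fun u : ℝ => u ^ ((k : ℝ) - 1 / 2 - 1) * (1 - u) ^ ((1 : ℝ) / 2 - 1)) (Set.Ioo 0 1) := by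
    intro u hu
    exact ((Real.continuousAt_rpow_const _ _ (Or.inl hu.1.ne')).mul
      ((continuous_const.sub continuous_id).continuousAt.rpow_const
        (Or.inl (by simpa using (sub_pos.2 hu.2).ne')))).continuousWithinAt
  have hd := intervalIntegral.integral_hasDerivAt_right
    ((intervalIntegrable_psiBeta hk).mono_set hsub)
    (hcont.stronglyMeasurableAtFilter isOpen_Ioo (w ^ 2) ⟨hw0, hw2⟩)
    (hcont.continuousAt (isOpen_Ioo.mem_nhds ⟨hw0, hw2⟩))
  have h := hd.const_mul (1 / 2 : ℝ)
  have e : 1 / 2 * ((w ^ 2) ^ ((k : ℝ) - 1 / 2 - 1) * (1 - w ^ 2) ^ ((1 : ℝ) / 2 - 1)) =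
      w ^ (2 * k - 3) / (2 * √(1 - w ^ 2)) := by
    have e1 : (w ^ 2) ^ ((k : ℝ) - 1 / 2 - 1) = w ^ (2 * k - 3) := by
      rw [← Real.rpow_natCast w (2 * k - 3), ← Real.rpow_natCast w 2, ← Real.rpow_mul h0.le,
        Nat.cast_sub (by omega)]
      congr 1
      push_cast
      ring
    have e2 : (1 - w ^ 2) ^ ((1 : ℝ) / 2 - 1) = (√(1 - w ^ 2))⁻¹ := by
      rw [Real.sqrt_eq_rpow, ← Real.rpow_neg (by linarith)]
      norm_num
    rw [e1, e2]
    field_simp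
  rw [e] at h
  exact h

/-! ### The size of `Q(z,1)`. -/

namespace IntBinForm

/-- `a |z| ^ 2 + b Re z + c` for `z` in the plane. -/
def circleFun (Q : IntBinForm) (z : ℂ) : ℝ := Q.a * ‖z‖ ^ 2 + Q.b * z.re + Q.c

/-- For positive discriminant this bounds the argument of `ψ` by `1`, with equality exactly on
`S_Q`, and bounds `|Q(z,1)|` below by `√D y`. -/
theorem norm_eval_sq (Q : IntBinForm) (z : ℂ) :
    ‖Q.eval z 1‖ ^ 2 = Q.circleFun z ^ 2 + Q.disc * z.im ^ 2 := by
  rw [circleFun, Complex.sq_norm, Complex.sq_norm, Complex.normSq_apply, Complex.normSq_apply, eval,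
    disc]
  simp [pow_two]
  ring

theorem continuous_circleFun (Q : IntBinForm) : Continuous Q.circleFun := by
  unfold circleFun; fun_prop

theorem hasDerivAt_eval (Q : IntBinForm) (z : ℂ) :
    HasDerivAt (fun w : ℂ => Q.eval w 1) (2 * Q.a * z + Q.b) z := by
  have h := (((hasDerivAt_id z).fun_pow 2).const_mul (Q.a : ℂ)).add
    ((hasDerivAt_id z).const_mul (Q.b : ℂ))
  have h2 := h.add_const (Q.c : ℂ)
  refine (h2.congr_deriv ?_).congr_of_eventuallyEq (Filter.Eventually.of_forall fun w => ?_)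
  · simp; ring
  · simp [eval]

/-- `|b| ≤ (1 / y + 2 |x| / y ^ 2) |Q(z, 1)|`. -/
theorem abs_b_le (Q : IntBinForm) (hQ : 0 ≤ Q.disc) {z : ℂ} (hz : 0 < z.im) :
    |(Q.b : ℝ)| ≤ (1 / z.im + 2 * |z.re| / z.im ^ 2) * ‖Q.eval z 1‖ := by
  set q := Q.eval z 1 with hq
  have hg : |Q.circleFun z| ≤ ‖q‖ := by
    refine abs_le_of_sq_le_sq ?_ (norm_nonneg _)
    rw [hq, norm_eval_sq]
    have : (0 : ℝ) ≤ Q.disc := by exact_mod_cast hQ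
    nlinarith [mul_nonneg this (sq_nonneg z.im)]
  -- The circle function and `Re Q(z,1)` differ by `2ay²`, and `Im Q(z,1) = 2axy + by`; hence `a`
  -- and then `b` are controlled by `|Q(z,1)|`.
  have ha : |(Q.a : ℝ)| * z.im ^ 2 ≤ ‖q‖ := by
    have e : 2 * (Q.a * z.im ^ 2) = Q.circleFun z - q.re := by
      rw [hq, circleFun, Complex.sq_norm, Complex.normSq_apply, eval]
      simp [pow_two]
      ring
    have h1 := abs_sub (Q.circleFun z) q.re
    rw [← e, abs_mul, abs_mul, abs_two, abs_of_pos (pow_pos hz 2)] at h1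
    linarith [Complex.abs_re_le_norm q]
  have hb : |(Q.b : ℝ)| * z.im ≤ ‖q‖ + 2 * |(Q.a : ℝ)| * |z.re| * z.im := by
    have e : Q.b * z.im = q.im - 2 * Q.a * z.re * z.im := by
      rw [hq, eval]
      simp [pow_two]
      ring
    have h1 := abs_sub q.im (2 * Q.a * z.re * z.im)
    rw [← e] at h1
    simp only [abs_mul, abs_two, abs_of_pos hz] at h1
    linarith [Complex.abs_im_le_norm q]
  have h2 : |(Q.a : ℝ)| * |z.re| * z.im ^ 2 ≤ ‖q‖ * |z.re| := by
    nlinarith [mul_le_mul_of_nonneg_right ha (abs_nonneg z.re)]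
  have e : (1 / z.im + 2 * |z.re| / z.im ^ 2) * ‖q‖ =
      (‖q‖ * z.im + 2 * (‖q‖ * |z.re|)) / z.im ^ 2 := by
    field_simp
  rw [e, le_div_iff₀ (by positivity)]
  nlinarith

end IntBinForm

/-- `D y ^ 2 / |Q(z, 1)| ^ 2`, which lies in `(0, 1]`. -/
def betaArg (D : ℤ) (Q : IntBinForm) (z : ℂ) : ℝ := D * z.im ^ 2 / ‖Q.eval z 1‖ ^ 2

/-- The summand of the series without its sign, as a function on the plane. -/
def unsignedTerm (k : ℕ) (D : ℤ) (Q : IntBinForm) (z : ℂ) : ℂ :=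
  Q.eval z 1 ^ (k - 1) * (psiBeta k (betaArg D Q z) : ℂ)

/-- The summand of the series as a function on the plane. -/
def planeTerm (k : ℕ) (D : ℤ) (Q : IntBinForm) (z : ℂ) : ℂ :=
  (Real.sign (Q.circleFun z) : ℂ) * unsignedTerm k D Q z

theorem maassTerm_eq_planeTerm (k : ℕ) (D : ℤ) (Q : IntBinForm) (τ : ℍ) :
    maassTerm k D Q τ = planeTerm k D Q τ := by
  rw [maassTerm, planeTerm, unsignedTerm, ← mul_assoc]; rfl

theorem Real.norm_sign_le_one (x : ℝ) : ‖(Real.sign x : ℂ)‖ ≤ 1 := by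
  rw [Complex.norm_real]
  rcases Real.sign_apply_eq x with h | h | h <;> simp [h]

theorem norm_planeTerm_le (k : ℕ) (D : ℤ) (Q : IntBinForm) (z : ℂ) :
    ‖planeTerm k D Q z‖ ≤ ‖unsignedTerm k D Q z‖ := by
  rw [planeTerm, norm_mul]
  exact mul_le_of_le_one_left (norm_nonneg _) (Real.norm_sign_le_one _)

/-! ### One term of the series: bound, continuity, image under `∂x + i∂y`. -/

section Term

variable {D : ℤ} {Q : IntBinForm} {z : ℂ}

theorem sqrt_mul_im_le_norm_eval (hD : 0 < D) (hQ : Q ∈ IntBinForm.ofDisc D) :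
    √D * z.im ≤ ‖Q.eval z 1‖ := by
  refine le_of_abs_le (abs_le_of_sq_le_sq ?_ (norm_nonneg _))
  have hQ' : Q.disc = D := hQ
  rw [Q.norm_eval_sq, hQ', mul_pow, Real.sq_sqrt (by exact_mod_cast hD.le)]
  nlinarith [sq_nonneg (Q.circleFun z)]

theorem sqrt_mul_im_pos (hD : 0 < D) (hz : 0 < z.im) : 0 < √(D : ℝ) * z.im :=
  mul_pos (Real.sqrt_pos.2 (by exact_mod_cast hD)) hz

theorem norm_eval_pos (hD : 0 < D) (hQ : Q ∈ IntBinForm.ofDisc D) (hz : 0 < z.im) :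
    0 < ‖Q.eval z 1‖ :=
  (sqrt_mul_im_pos hD hz).trans_le (sqrt_mul_im_le_norm_eval hD hQ)

theorem eval_ne_zero (hD : 0 < D) (hQ : Q ∈ IntBinForm.ofDisc D) (hz : 0 < z.im) :
    Q.eval z 1 ≠ 0 := norm_pos_iff.1 (norm_eval_pos hD hQ hz)

theorem betaArg_eq_sq (hD : 0 < D) (Q : IntBinForm) (z : ℂ) :
    betaArg D Q z = (√D * z.im / ‖Q.eval z 1‖) ^ 2 := by
  rw [betaArg, div_pow, mul_pow, Real.sq_sqrt (by exact_mod_cast hD.le)]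

theorem betaArg_mem_Icc (hD : 0 < D) (hQ : Q ∈ IntBinForm.ofDisc D) (hz : 0 < z.im) :
    betaArg D Q z ∈ Set.Icc (0 : ℝ) 1 := by
  rw [betaArg_eq_sq hD]
  have h := norm_eval_pos hD hQ hz
  exact ⟨sq_nonneg _, pow_le_one₀ (div_nonneg (sqrt_mul_im_pos hD hz).le h.le)
    ((div_le_one h).2 (sqrt_mul_im_le_norm_eval hD hQ))⟩

/-- With `s = √D y`, `q = |Q(z,1)|` and `w = s/q ≤ 1`, one has `q^(k-1) w^(2k-1) = (s^(k+1)/q²)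
w^(k-2)`, and the last factor is at most `1`. -/
theorem norm_unsignedTerm_le {k : ℕ} (hk : 1 < k) (hD : 0 < D) (hQ : Q ∈ IntBinForm.ofDisc D)
    (hz : 0 < z.im) :
    ‖unsignedTerm k D Q z‖ ≤ (√D * z.im) ^ (k + 1) / ‖Q.eval z 1‖ ^ 2 := by
  have hq := norm_eval_pos hD hQ hz
  have hle := sqrt_mul_im_le_norm_eval (z := z) hD hQ
  have hs := sqrt_mul_im_pos hD hz
  obtain ⟨h1, h2⟩ := psiBeta_sq_nonneg_le hk (div_nonneg hs.le hq.le) ((div_le_one hq).2 hle)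
  rw [unsignedTerm, betaArg_eq_sq hD, norm_mul, norm_pow,
    Complex.norm_of_nonneg h1]
  refine (mul_le_mul_of_nonneg_left h2 (by positivity)).trans ?_
  obtain ⟨m, rfl⟩ := Nat.exists_eq_add_of_le' (show 2 ≤ k from hk)
  rw [show 2 * (m + 2) - 1 = 2 * m + 3 by omega, show m + 2 - 1 = m + 1 by omega]
  generalize ‖Q.eval z 1‖ = q at *
  generalize √(D : ℝ) * z.im = s at *
  have e : q ^ (m + 1) * (s / q) ^ (2 * m + 3) = s ^ (m + 2 + 1) / q ^ 2 * (s / q) ^ m := by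
    rw [div_pow, div_pow, mul_div_assoc', div_mul_div_comm, div_eq_div_iff (by positivity)
      (by positivity)]
    ring
  rw [e]
  exact mul_le_of_le_one_right (by positivity)
    (pow_le_one₀ (by positivity) ((div_le_one hq).2 hle))

theorem continuousAt_eval (Q : IntBinForm) (z : ℂ) : ContinuousAt (fun w : ℂ => Q.eval w 1) z :=
  (Q.hasDerivAt_eval z).continuousAt

theorem continuousAt_unsignedTerm {k : ℕ} (hk : 1 < k) (hD : 0 < D)
    (hQ : Q ∈ IntBinForm.ofDisc D) (hz : 0 < z.im) : ContinuousAt (unsignedTerm k D Q) z := by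
  have hopen : {w : ℂ | 0 < w.im} ∈ 𝓝 z :=
    (isOpen_lt continuous_const Complex.continuous_im).mem_nhds hz
  have hq := norm_eval_pos hD hQ hz
  have harg : ContinuousAt (betaArg D Q) z := by
    refine ContinuousAt.div₀ ?_ ((continuousAt_eval Q z).norm.pow 2) (by positivity)
    exact (continuous_const.mul (Complex.continuous_im.pow 2)).continuousAt
  have hpsi : ContinuousAt (fun w => psiBeta k (betaArg D Q w)) z := by
    -- On `S_Q` the argument reaches the endpoint `1`, where only continuity of `ψ` within `[0, 1]`
    -- is available.
    have h1 : Filter.Tendsto (betaArg D Q) (𝓝 z) (𝓝[Set.Icc 0 1] (betaArg D Q z)) :=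
      tendsto_nhdsWithin_iff.2 ⟨harg, Filter.mem_of_superset hopen
        fun w hw => betaArg_mem_Icc hD hQ hw⟩
    exact (continuousOn_psiBeta hk _ (betaArg_mem_Icc hD hQ hz)).tendsto.comp h1
  exact ((continuousAt_eval Q z).pow _).mul (Complex.continuous_ofReal.continuousAt.comp hpsi)

theorem sign_circleFun_eventuallyEq (hz : Q.circleFun z ≠ 0) :
    ∀ᶠ w in 𝓝 z, Real.sign (Q.circleFun w) = Real.sign (Q.circleFun z) := by
  rcases lt_or_gt_of_ne hz with h | h
  · filter_upwards [Q.continuous_circleFun.continuousAt.eventually_lt_const h] with w hw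
    rw [Real.sign_of_neg hw, Real.sign_of_neg h]
  · filter_upwards [Q.continuous_circleFun.continuousAt.eventually_const_lt h] with w hw
    rw [Real.sign_of_pos hw, Real.sign_of_pos h]

theorem cauchyRiemannOp_betaArg (hD : 0 < D) (hQ : Q ∈ IntBinForm.ofDisc D) (hz : 0 < z.im) :
    DifferentiableAt ℝ (betaArg D Q) z ∧
    cauchyRiemannOp (fun w => (betaArg D Q w : ℂ)) z =
      2 * Complex.I * D * z.im * Q.circleFun z / (Q.eval z 1 * conj (Q.eval z 1) ^ 2) := by
  have hq := eval_ne_zero hD hQ hz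
  have hd := Q.hasDerivAt_eval z
  have hinv := hd.fun_inv hq
  have e : ∀ w, (betaArg D Q w : ℂ) =
      (D * (Q.eval w 1)⁻¹) * ((w.im : ℂ) ^ 2 * conj ((Q.eval w 1)⁻¹)) := fun w => by
    rw [betaArg]
    push_cast
    rw [← Complex.mul_conj', map_inv₀, div_eq_mul_inv, mul_inv]
    ring
  constructor
  · have h1 : DifferentiableAt ℝ (fun w : ℂ => (D : ℝ) * w.im ^ 2) z :=
      ((Complex.imCLM.differentiableAt).pow 2).const_mul _
    have h2 : DifferentiableAt ℝ (fun w : ℂ => Q.eval w 1) z :=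
      (hd.differentiableAt).restrictScalars ℝ
    exact h1.mul ((h2.norm_sq ℝ).inv (by simpa using hq))
  · obtain ⟨f', hf', -⟩ := hasFDerivAt_im_pow_mul_conj 2 hinv
    rw [funext e, cauchyRiemannOp_mul (hinv.differentiableAt.const_mul _) hf'.differentiableAt,
      cauchyRiemannOp_im_pow_mul_conj 2 hinv]
    have hqc : conj (Q.eval z 1) ≠ 0 := (map_ne_zero _).2 hq
    -- Differentiating `y² conj(1/Q)` produces this combination of `Q` and its derivative; it
    -- collapses to the real circle function.
    have hcirc : Complex.I * conj (Q.eval z 1) - z.im * conj (2 * Q.a * z + Q.b) =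
        Complex.I * Q.circleFun z := by
      have hcf : Q.circleFun z = Q.a * (z.re * z.re + z.im * z.im) + Q.b * z.re + Q.c := by
        rw [IntBinForm.circleFun, Complex.sq_norm, Complex.normSq_apply]
      apply Complex.ext <;> simp [hcf, IntBinForm.eval, pow_two] <;> ring
    rw [map_inv₀, map_div₀, map_neg, map_pow]
    field_simp
    push_cast
    linear_combination (2 * D * z.im : ℂ) * hcirc

/-- Since `√(1 - v) = |g| / |Q(z,1)|` for the argument `v` of `ψ`, the derivative `ψ'(v)` carries
`1/|g|`, while `∂x + i∂y` of `v` carries `g`. The sign of `g` cancels both, and the result no longer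
depends on the side of `S_Q`. -/
theorem cauchyRiemannOp_planeTerm {k : ℕ} (hk : 1 < k) (hD : 0 < D)
    (hQ : Q ∈ IntBinForm.ofDisc D) (hz : 0 < z.im) (hc : Q.circleFun z ≠ 0) :
    DifferentiableAt ℝ (planeTerm k D Q) z ∧
    cauchyRiemannOp (planeTerm k D Q) z =
      (z.im : ℂ) ^ (2 * k - 2) * conj (-Complex.I * (√D : ℂ) ^ (2 * k - 1) / Q.eval z 1 ^ k) := by
  have hq := eval_ne_zero hD hQ hz
  have hqn := norm_eval_pos hD hQ hz
  have hs := sqrt_mul_im_pos hD hz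
  have hsq := Q.norm_eval_sq z
  have hQ' : Q.disc = D := hQ
  have hDsq : √(D : ℝ) ^ 2 = D := Real.sq_sqrt (by exact_mod_cast hD.le)
  have hlt : √D * z.im / ‖Q.eval z 1‖ < 1 := by
    rw [div_lt_one hqn]
    refine lt_of_pow_lt_pow_left₀ 2 hqn.le ?_
    rw [hsq, hQ', mul_pow, hDsq]
    have := pow_pos (abs_pos.2 hc) 2
    rw [sq_abs] at this
    linarith
  have hpsi := hasDerivAt_psiBeta_sq hk (div_pos hs hqn) hlt
  have hroot : √(1 - (√D * z.im / ‖Q.eval z 1‖) ^ 2) = |Q.circleFun z| / ‖Q.eval z 1‖ := by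
    rw [Real.sqrt_eq_iff_eq_sq, div_pow, div_pow, mul_pow, sq_abs, hDsq]
    · rw [hQ'] at hsq
      field_simp
      linarith
    · have := pow_le_one₀ (n := 2) (div_pos hs hqn).le hlt.le
      linarith
    · positivity
  rw [hroot, ← betaArg_eq_sq hD] at hpsi
  obtain ⟨hbd, hbc⟩ := cauchyRiemannOp_betaArg hD hQ hz
  obtain ⟨hpd, hpc⟩ := cauchyRiemannOp_ofReal_comp hpsi hbd
  have hqd : DifferentiableAt ℂ (fun w : ℂ => (Real.sign (Q.circleFun z) : ℂ) *
      Q.eval w 1 ^ (k - 1)) z := ((Q.hasDerivAt_eval z).differentiableAt.pow _).const_mul _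
  have hev : planeTerm k D Q =ᶠ[𝓝 z] fun w => ((Real.sign (Q.circleFun z) : ℂ) *
      Q.eval w 1 ^ (k - 1)) * (psiBeta k (betaArg D Q w) : ℂ) := by
    filter_upwards [sign_circleFun_eventuallyEq hc] with w hw
    rw [planeTerm, hw, unsignedTerm, mul_assoc]
  refine ⟨(((hqd.restrictScalars ℝ).mul hpd).congr_of_eventuallyEq hev), ?_⟩
  rw [hev.cauchyRiemannOp_eq, cauchyRiemannOp_mul hqd hpd, hpc, hbc]
  have hsign : (Real.sign (Q.circleFun z) : ℂ) * Q.circleFun z = (|Q.circleFun z| : ℝ) := by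
    exact_mod_cast (show Real.sign (Q.circleFun z) * Q.circleFun z = |Q.circleFun z| by
      rcases lt_or_gt_of_ne hc with h | h
      · rw [Real.sign_of_neg h, abs_of_neg h]; ring
      · rw [Real.sign_of_pos h, abs_of_pos h]; ring)
  have habs : ((|Q.circleFun z| : ℝ) : ℂ) ≠ 0 := by exact_mod_cast abs_ne_zero.2 hc
  have hDc : (D : ℂ) = (√(D : ℝ) : ℂ) ^ 2 := by
    rw [← Complex.ofReal_pow, hDsq]; simp
  obtain ⟨m, rfl⟩ := Nat.exists_eq_add_of_le' (show 2 ≤ k from hk)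
  rw [show 2 * (m + 2) - 3 = 2 * m + 1 by omega, show m + 2 - 1 = m + 1 by omega,
    show 2 * (m + 2) - 2 = 2 * m + 2 by omega, show 2 * (m + 2) - 1 = 2 * m + 3 by omega]
  have hn : ((‖Q.eval z 1‖ : ℝ) : ℂ) ≠ 0 := by exact_mod_cast hqn.ne'
  have hnn : ((‖Q.eval z 1‖ : ℝ) : ℂ) ^ (2 * m) = (Q.eval z 1) ^ m * conj (Q.eval z 1) ^ m := by
    rw [pow_mul, ← Complex.mul_conj', mul_pow]
  have hqc : conj (Q.eval z 1) ≠ 0 := (map_ne_zero _).2 hq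
  simp only [map_div₀, map_mul, map_neg, map_pow, Complex.conj_I, Complex.conj_ofReal]
  push_cast
  rw [hDc]
  generalize Q.eval z 1 = q at *
  generalize conj q = q' at *
  generalize (Real.sign (Q.circleFun z) : ℂ) = σ at *
  generalize ((|Q.circleFun z| : ℝ) : ℂ) = A at *
  generalize (Q.circleFun z : ℂ) = g at *
  generalize (√(D : ℝ) : ℂ) = s at *
  generalize (z.im : ℂ) = y at *
  generalize (‖q‖ : ℂ) = N at *
  subst hsign
  have hσ := left_ne_zero_of_mul habs
  have hg := right_ne_zero_of_mul habs
  rw [div_pow, pow_succ N, hnn]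
  field_simp
  ring

end Term

/-! ### The substitution action and modularity. -/

namespace IntBinForm

theorem comp_comp (Q : IntBinForm) (γ γ' : SL(2, ℤ)) : (Q.comp γ).comp γ' = Q.comp (γ * γ') := by
  ext <;> simp only [comp, Matrix.SpecialLinearGroup.coe_mul, Matrix.mul_apply, Fin.sum_univ_two] <;>
    ring

theorem comp_one (Q : IntBinForm) : Q.comp 1 = Q := by
  ext <;> simp [comp]

theorem disc_comp (Q : IntBinForm) (γ : SL(2, ℤ)) : (Q.comp γ).disc = Q.disc := by
  have h : γ 0 0 * γ 1 1 - γ 0 1 * γ 1 0 = 1 := by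
    rw [← Matrix.det_fin_two]; exact γ.det_coe
  have e : (Q.comp γ).disc = Q.disc * (γ 0 0 * γ 1 1 - γ 0 1 * γ 1 0) ^ 2 := by
    simp only [disc, comp]; ring
  rw [e, h]; ring

theorem comp_mem_ofDisc {D : ℤ} {Q : IntBinForm} (hQ : Q ∈ ofDisc D) (γ : SL(2, ℤ)) :
    Q.comp γ ∈ ofDisc D := (disc_comp Q γ).trans hQ

theorem comp_mem_narrowClass {Q₀ Q : IntBinForm} (hQ : Q ∈ Q₀.narrowClass) (γ : SL(2, ℤ)) :
    Q.comp γ ∈ Q₀.narrowClass := by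
  obtain ⟨γ', rfl⟩ := hQ
  exact ⟨γ' * γ, comp_comp _ _ _⟩

theorem narrowClass_subset_ofDisc {D : ℤ} {Q₀ : IntBinForm} (hQ : Q₀ ∈ ofDisc D) :
    Q₀.narrowClass ⊆ ofDisc D := by
  rintro _ ⟨γ, rfl⟩
  exact comp_mem_ofDisc hQ γ

/-- The permutation of an `SL(2, ℤ)`-stable set of forms induced by `γ`. -/
def compEquiv {A : Set IntBinForm} (hA : ∀ Q ∈ A, ∀ γ : SL(2, ℤ), Q.comp γ ∈ A) (γ : SL(2, ℤ)) :
    A ≃ A where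
  toFun Q := ⟨Q.1.comp γ, hA _ Q.2 γ⟩
  invFun Q := ⟨Q.1.comp γ⁻¹, hA _ Q.2 γ⁻¹⟩
  left_inv Q := Subtype.ext (by simp [comp_comp, comp_one])
  right_inv Q := Subtype.ext (by simp [comp_comp, comp_one])

theorem ofReal_circleFun (Q : IntBinForm) (z : ℂ) :
    (Q.circleFun z : ℂ) = Q.a * (z * conj z) + Q.b * ((z + conj z) / 2) + Q.c := by
  rw [circleFun, Complex.mul_conj', ← Complex.re_eq_add_conj]
  push_cast
  ring

end IntBinForm

section Modularity

open UpperHalfPlane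

variable (γ : SL(2, ℤ)) (τ : ℍ)

theorem coe_smul_eq_div_denom :
    ((γ • τ : ℍ) : ℂ) = ((γ 0 0 : ℂ) * τ + (γ 0 1 : ℂ)) / denom γ τ := by
  rw [coe_specialLinearGroup_apply, ModularGroup.denom_apply]
  simp

theorem eval_smul (Q : IntBinForm) :
    Q.eval ((γ • τ : ℍ) : ℂ) 1 = (Q.comp γ).eval (τ : ℂ) 1 / denom γ τ ^ 2 := by
  have hd : denom γ τ ≠ 0 := denom_ne_zero _ _
  rw [IntBinForm.eval_comp, coe_smul_eq_div_denom, mul_one, mul_one, ← ModularGroup.denom_apply,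
    IntBinForm.eval, IntBinForm.eval]
  field_simp

theorem circleFun_smul (Q : IntBinForm) :
    Q.circleFun ((γ • τ : ℍ) : ℂ) = (Q.comp γ).circleFun (τ : ℂ) / ‖denom γ τ‖ ^ 2 := by
  have hd : denom γ τ ≠ 0 := denom_ne_zero _ _
  have hd' : conj (denom γ τ) ≠ 0 := (map_ne_zero _).2 hd
  apply Complex.ofReal_injective
  push_cast
  rw [← Complex.mul_conj', IntBinForm.ofReal_circleFun, IntBinForm.ofReal_circleFun,
    coe_smul_eq_div_denom, map_div₀]
  field_simp
  rw [ModularGroup.denom_apply]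
  simp only [IntBinForm.comp, map_add, map_mul, map_intCast]
  push_cast
  generalize conj (τ : ℂ) = t'
  ring

/-- The sign and the argument of `ψ` are invariant, since the circle function and `Im` are both
divided by the positive number `|cτ+d|²`; only `Q(τ,1)^(k-1)` contributes an automorphy factor. -/
theorem maassTerm_smul {k : ℕ} (hk : 1 < k) (D : ℤ) (Q : IntBinForm) :
    maassTerm k D Q (γ • τ) * denom γ τ ^ (-(2 - 2 * (k : ℤ))) = maassTerm k D (Q.comp γ) τ := by
  have hd : denom γ τ ≠ 0 := denom_ne_zero _ _
  have hdn : 0 < ‖denom γ τ‖ := norm_pos_iff.2 hd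
  have hsign : Real.sign (Q.circleFun ((γ • τ : ℍ) : ℂ)) =
      Real.sign ((Q.comp γ).circleFun (τ : ℂ)) := by
    rw [circleFun_smul]
    have hp : 0 < ‖denom γ τ‖ ^ 2 := by positivity
    rcases lt_trichotomy ((Q.comp γ).circleFun (τ : ℂ)) 0 with h | h | h
    · rw [Real.sign_of_neg h, Real.sign_of_neg (div_neg_of_neg_of_pos h hp)]
    · rw [h, zero_div]
    · rw [Real.sign_of_pos h, Real.sign_of_pos (div_pos h hp)]
  have harg : betaArg D Q ((γ • τ : ℍ) : ℂ) = betaArg D (Q.comp γ) (τ : ℂ) := by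
    rw [betaArg, betaArg, eval_smul, UpperHalfPlane.coe_im, ModularGroup.im_smul_eq_div_normSq,
      Complex.normSq_eq_norm_sq, norm_div, norm_pow, UpperHalfPlane.coe_im]
    field_simp
  have hpow : denom γ τ ^ (-(2 - 2 * (k : ℤ))) = (denom γ τ ^ 2) ^ (k - 1) := by
    rw [← pow_mul, ← zpow_natCast]
    congr 1
    omega
  rw [maassTerm_eq_planeTerm, maassTerm_eq_planeTerm, planeTerm, planeTerm, unsignedTerm,
    unsignedTerm, hsign, harg, eval_smul, hpow, div_pow]
  field_simp

theorem slash_tsum_maassTerm {k : ℕ} (hk : 1 < k) (D : ℤ) {A : Set IntBinForm}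
    (hA : ∀ Q ∈ A, ∀ γ : SL(2, ℤ), Q.comp γ ∈ A) (C : ℂ) :
    (fun τ : ℍ => C * ∑' Q : A, maassTerm k D Q τ) ∣[2 - 2 * (k : ℤ)] γ =
      fun τ : ℍ => C * ∑' Q : A, maassTerm k D Q τ := by
  ext τ
  rw [ModularForm.SL_slash_apply, mul_assoc, ← tsum_mul_right]
  congr 1
  rw [← (IntBinForm.compEquiv hA γ).tsum_eq fun Q : A => maassTerm k D Q τ]
  exact tsum_congr fun Q => maassTerm_smul γ τ hk D Q

end Modularity

/-! ### Bounds by `(1 + |b|)⁻²`, uniform in `z`. -/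

section Bounds

variable {D : ℤ}

theorem exists_one_add_abs_le_norm_eval (hD : 0 < D) {δ B : ℝ} (hδ : 0 < δ) :
    ∃ M : ℝ, 0 < M ∧ ∀ Q ∈ IntBinForm.ofDisc D, ∀ z : ℂ, δ ≤ z.im → |z.re| ≤ B →
      1 + |(Q.b : ℝ)| ≤ M * ‖Q.eval z 1‖ := by
  have hs : 0 < √(D : ℝ) := Real.sqrt_pos.2 (by exact_mod_cast hD)
  -- The first summand pays for `1`, through `|Q(z,1)| ≥ √D δ`; the bracket pays for `|b|`.
  refine ⟨1 / (√D * δ) + (1 / δ + 2 * |B| / δ ^ 2), by positivity, fun Q hQ z hz hB => ?_⟩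
  have hz0 : 0 < z.im := hδ.trans_le hz
  have hQ' : Q.disc = D := hQ
  have h1 := Q.abs_b_le (hQ'.symm ▸ hD.le) hz0
  have h2 : (1 / z.im + 2 * |z.re| / z.im ^ 2) ≤ 1 / δ + 2 * |B| / δ ^ 2 := by
    have := hB.trans (le_abs_self B)
    gcongr
  have h3 : 1 ≤ 1 / (√D * δ) * ‖Q.eval z 1‖ := by
    rw [div_mul_eq_mul_div, one_mul, le_div_iff₀ (by positivity), one_mul]
    exact (mul_le_mul_of_nonneg_left hz hs.le).trans (sqrt_mul_im_le_norm_eval hD hQ)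
  have h4 := mul_le_mul_of_nonneg_right h2 (norm_nonneg (Q.eval z 1))
  rw [add_mul]
  linarith

theorem exists_one_div_norm_eval_sq_le (hD : 0 < D) {δ B : ℝ} (hδ : 0 < δ) :
    ∃ M : ℝ, 0 < M ∧ ∀ Q ∈ IntBinForm.ofDisc D, ∀ z : ℂ, δ ≤ z.im → |z.re| ≤ B →
      1 / ‖Q.eval z 1‖ ^ 2 ≤ M * (1 / (1 + |(Q.b : ℝ)|) ^ 2) := by
  obtain ⟨M, hM, h⟩ := exists_one_add_abs_le_norm_eval hD (B := B) hδ
  refine ⟨M ^ 2, by positivity, fun Q hQ z hz hB => ?_⟩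
  have hq := norm_eval_pos hD hQ (hδ.trans_le hz)
  rw [mul_one_div, div_le_div_iff₀ (by positivity) (by positivity), one_mul, ← mul_pow]
  exact pow_le_pow_left₀ (by positivity) (h Q hQ z hz hB) 2

theorem exists_norm_unsignedTerm_le {k : ℕ} (hk : 1 < k) (hD : 0 < D) {δ B : ℝ} (hδ : 0 < δ) :
    ∃ M : ℝ, 0 < M ∧ ∀ Q ∈ IntBinForm.ofDisc D, ∀ z : ℂ, δ ≤ z.im → |z.re| ≤ B →
      ‖unsignedTerm k D Q z‖ ≤ z.im ^ (k + 1) * (M * (1 / (1 + |(Q.b : ℝ)|) ^ 2)) := by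
  obtain ⟨M, hM, h⟩ := exists_one_div_norm_eval_sq_le hD (B := B) hδ
  have hs : 0 < √(D : ℝ) := Real.sqrt_pos.2 (by exact_mod_cast hD)
  refine ⟨√D ^ (k + 1) * M, by positivity, fun Q hQ z hz hB => ?_⟩
  have hz0 := hδ.trans_le hz
  calc ‖unsignedTerm k D Q z‖ ≤ (√D * z.im) ^ (k + 1) / ‖Q.eval z 1‖ ^ 2 :=
        norm_unsignedTerm_le hk hD hQ hz0
    _ = (√D * z.im) ^ (k + 1) * (1 / ‖Q.eval z 1‖ ^ 2) := by rw [mul_one_div]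
    _ ≤ (√D * z.im) ^ (k + 1) * (M * (1 / (1 + |(Q.b : ℝ)|) ^ 2)) :=
        mul_le_mul_of_nonneg_left (h Q hQ z hz hB) (by positivity)
    _ = _ := by rw [mul_pow]; ring

theorem exists_norm_unsignedTerm_le_of_norm_le {k : ℕ} (hk : 1 < k) (hD : 0 < D) {δ : ℝ} (B : ℝ)
    (hδ : 0 < δ) :
    ∃ M : ℝ, ∀ Q ∈ IntBinForm.ofDisc D, ∀ z : ℂ, δ ≤ z.im → ‖z‖ ≤ B →
      ‖unsignedTerm k D Q z‖ ≤ M * (1 / (1 + |(Q.b : ℝ)|) ^ 2) := by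
  obtain ⟨M, hM, h⟩ := exists_norm_unsignedTerm_le hk hD (B := B) hδ
  refine ⟨B ^ (k + 1) * M, fun Q hQ z hz hB => ?_⟩
  refine (h Q hQ z hz ((Complex.abs_re_le_norm z).trans hB)).trans ?_
  rw [mul_assoc]
  exact mul_le_mul_of_nonneg_right (pow_le_pow_left₀ (hδ.le.trans hz)
    ((le_abs_self _).trans ((Complex.abs_im_le_norm z).trans hB)) _) (by positivity)

theorem exists_norm_planeTerm_le_of_norm_le {k : ℕ} (hk : 1 < k) (hD : 0 < D) {δ : ℝ} (B : ℝ)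
    (hδ : 0 < δ) :
    ∃ M : ℝ, ∀ Q ∈ IntBinForm.ofDisc D, ∀ z : ℂ, δ ≤ z.im → ‖z‖ ≤ B →
      ‖planeTerm k D Q z‖ ≤ M * (1 / (1 + |(Q.b : ℝ)|) ^ 2) := by
  obtain ⟨M, h⟩ := exists_norm_unsignedTerm_le_of_norm_le hk hD B hδ
  exact ⟨M, fun Q hQ z hz hB => (norm_planeTerm_le k D Q z).trans (h Q hQ z hz hB)⟩

theorem summable_subset {A : Set IntBinForm} (hsq : ¬ IsSquare D) (hA : A ⊆ IntBinForm.ofDisc D) :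
    Summable fun Q : A => 1 / (1 + |(Q.1.b : ℝ)|) ^ 2 :=
  (IntBinForm.summable_one_div_sq hsq).comp_injective
    (i := fun Q : A => (⟨Q.1, hA Q.2⟩ : IntBinForm.ofDisc D)) fun _ _ h =>
      Subtype.ext (congrArg (fun Q' : IntBinForm.ofDisc D => Q'.1) h)

/-- The terms of a convergent series tend to `0` along the cofinite filter, so all but finitely many
forms have `1 + |b| > R`. -/
theorem finite_abs_b_le {A : Set IntBinForm} (hsq : ¬ IsSquare D) (hA : A ⊆ IntBinForm.ofDisc D)
    (R : ℝ) : {Q : A | 1 + |(Q.1.b : ℝ)| ≤ R}.Finite := by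
  rcases le_or_gt R 0 with hR | hR
  · convert Set.finite_empty
    ext Q
    simp only [Set.mem_ofPred_eq, Set.mem_empty_iff_false, iff_false, not_le]
    linarith [abs_nonneg (Q.1.b : ℝ)]
  have h := (summable_subset hsq hA).tendsto_cofinite_zero.eventually_lt_const
    (show (0 : ℝ) < 1 / R ^ 2 by positivity)
  refine Set.Finite.subset (Filter.eventually_cofinite.1 h) fun Q hQ => ?_
  have hQ' : 1 + |(Q.1.b : ℝ)| ≤ R := hQ
  exact not_lt.2 (one_div_le_one_div_of_le (by positivity) (pow_le_pow_left₀ (by positivity) hQ' 2))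

end Bounds

theorem convergesCompactly_maassTerm {k : ℕ} (hk : 1 < k) {D : ℤ} (hD : 0 < D)
    (hsq : ¬ IsSquare D) {A : Set IntBinForm} (hA : A ⊆ IntBinForm.ofDisc D) :
    ConvergesCompactly fun (Q : A) (τ : ℍ) => maassTerm k D Q τ := by
  constructor
  · intro τ
    obtain ⟨M, hM⟩ := exists_norm_planeTerm_le_of_norm_le hk hD ‖(τ : ℂ)‖ τ.im_pos
    refine Summable.of_nonneg_of_le (fun _ => norm_nonneg _) (fun Q => ?_)
      ((summable_subset hsq hA).mul_left M)
    simp only [maassTerm_eq_planeTerm]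
    exact hM Q (hA Q.2) τ le_rfl le_rfl
  · intro K hK
    rcases K.eq_empty_or_nonempty with rfl | hne
    · exact HasSumUniformlyOn.of_norm_le_summable (summable_subset hsq hA) (by simp)
    obtain ⟨τ₀, -, hmin⟩ := hK.exists_isMinOn hne UpperHalfPlane.continuous_im.continuousOn
    obtain ⟨τ₁, -, hmax⟩ := hK.exists_isMaxOn hne UpperHalfPlane.continuous_coe.norm.continuousOn
    obtain ⟨M, hM⟩ := exists_norm_planeTerm_le_of_norm_le hk hD ‖(τ₁ : ℂ)‖ τ₀.im_pos
    refine HasSumUniformlyOn.of_norm_le_summable ((summable_subset hsq hA).mul_left M)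
      fun Q τ hτ => ?_
    simp only [maassTerm_eq_planeTerm]
    exact hM Q (hA Q.2) τ (hmin hτ) (hmax hτ)

theorem toPlane_tsum_maassTerm {k : ℕ} {D : ℤ} {A : Set IntBinForm} (C : ℂ) {z : ℂ}
    (hz : 0 < z.im) :
    toPlane (fun τ => C * ∑' Q : A, maassTerm k D Q τ) z = C * ∑' Q : A, planeTerm k D Q z := by
  rw [toPlane, UpperHalfPlane.ofComplex_apply_of_im_pos hz]
  simp only [maassTerm_eq_planeTerm]

/-! ### Local harmonicity off the exceptional set. -/

section Harmonic

variable {D : ℤ} {A : Set IntBinForm}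

theorem norm_cauchyRiemannOp_density_le {k : ℕ} (hk : 1 < k) (hD : 0 < D) {Q : IntBinForm}
    (hQ : Q ∈ IntBinForm.ofDisc D) {δ : ℝ} (hδ : 0 < δ) {z : ℂ} (hz : δ ≤ z.im) :
    ‖-Complex.I * (√D : ℂ) ^ (2 * k - 1) / Q.eval z 1 ^ k‖ ≤
      √D ^ (2 * k - 1) / (√D * δ) ^ (k - 2) * (1 / ‖Q.eval z 1‖ ^ 2) := by
  have hs : 0 < √(D : ℝ) := Real.sqrt_pos.2 (by exact_mod_cast hD)
  have hle : √D * δ ≤ ‖Q.eval z 1‖ :=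
    (mul_le_mul_of_nonneg_left hz hs.le).trans (sqrt_mul_im_le_norm_eval hD hQ)
  have hq := norm_eval_pos hD hQ (hδ.trans_le hz)
  rw [norm_div, norm_mul, norm_neg, Complex.norm_I, one_mul, norm_pow, norm_pow,
    Complex.norm_of_nonneg hs.le, div_mul_div_comm, mul_one]
  obtain ⟨m, rfl⟩ := Nat.exists_eq_add_of_le' (show 2 ≤ k from hk)
  rw [Nat.add_sub_cancel, pow_add ‖Q.eval z 1‖]
  gcongr

/-- On `S_Q` one has `|Q(z,1)| = √D y`, so a geodesic passing close to `τ` belongs to a form with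
bounded `b`. Only finitely many forms remain, and continuity keeps each of their circle functions
away from zero near `τ`. -/
theorem exists_ball_circleFun_ne_zero (hD : 0 < D) (hsq : ¬ IsSquare D)
    (hA : A ⊆ IntBinForm.ofDisc D) {τ : ℍ} (hτ : τ ∉ exceptionalSet D) :
    ∃ r : ℝ, 0 < r ∧ ∀ z ∈ ball (τ : ℂ) r, τ.im / 2 ≤ z.im ∧ ‖z‖ ≤ ‖(τ : ℂ)‖ + 1 ∧
      ∀ Q ∈ A, Q.circleFun z ≠ 0 := by
  have hy := τ.im_pos
  have hτ0 : ∀ Q ∈ A, Q.circleFun τ ≠ 0 := fun Q hQ h =>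
    hτ (Set.mem_biUnion (hA hQ) (show Q.geodesicFun τ = 0 from h))
  obtain ⟨M, hM, hb⟩ := exists_one_add_abs_le_norm_eval hD (B := ‖(τ : ℂ)‖ + 1) (half_pos hy)
  have hfin := finite_abs_b_le hsq hA (M * (√D * (‖(τ : ℂ)‖ + 1)))
  have h1 : ∀ᶠ z : ℂ in 𝓝 (τ : ℂ), τ.im / 2 < z.im :=
    Complex.continuous_im.continuousAt.eventually_const_lt (by simpa using hy)
  have h2 : ∀ᶠ z : ℂ in 𝓝 (τ : ℂ), ‖z‖ < ‖(τ : ℂ)‖ + 1 :=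
    continuous_norm.continuousAt.eventually_lt_const (by linarith)
  have h3 : ∀ᶠ z : ℂ in 𝓝 (τ : ℂ), ∀ Q ∈ {Q : A | 1 + |(Q.1.b : ℝ)| ≤
      M * (√D * (‖(τ : ℂ)‖ + 1))}, Q.1.circleFun z ≠ 0 :=
    (Filter.eventually_all_finite hfin).2 fun Q _ =>
      Q.1.continuous_circleFun.continuousAt.eventually_ne (hτ0 Q Q.2)
  obtain ⟨r, hr, hball⟩ := Metric.eventually_nhds_iff_ball.1 (h1.and (h2.and h3))
  refine ⟨r, hr, fun z hz => ?_⟩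
  obtain ⟨hz1, hz2, hz3⟩ := hball z hz
  refine ⟨hz1.le, hz2.le, fun Q hQ hQz => hz3 ⟨Q, hQ⟩ ?_ hQz⟩
  refine (hb Q (hA hQ) z hz1.le ((Complex.abs_re_le_norm z).trans hz2.le)).trans
    (mul_le_mul_of_nonneg_left ?_ hM.le)
  have hQ' : Q.disc = D := hA hQ
  have hsqe := Q.norm_eval_sq z
  have him0 : 0 ≤ z.im := (half_pos hy).le.trans hz1.le
  have hDr : (0 : ℝ) ≤ D := by exact_mod_cast hD.le
  have heq : ‖Q.eval z 1‖ = √D * z.im := by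
    rw [← sq_eq_sq₀ (norm_nonneg _) (by positivity), hsqe, hQz, hQ', mul_pow, Real.sq_sqrt hDr]
    ring
  rw [heq]
  exact mul_le_mul_of_nonneg_left ((le_abs_self _).trans ((Complex.abs_im_le_norm z).trans hz2.le))
    (Real.sqrt_nonneg _)

theorem locally_harmonic_tsum_maassTerm {k : ℕ} (hk : 1 < k) (hD : 0 < D) (hsq : ¬ IsSquare D)
    (hA : A ⊆ IntBinForm.ofDisc D) (C : ℂ) {τ : ℍ} (hτ : τ ∉ exceptionalSet D) :
    ∃ N : Set ℂ, IsOpen N ∧ (τ : ℂ) ∈ N ∧ (∀ z ∈ N, 0 < z.im) ∧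
      AnalyticOnNhd ℝ (toPlane fun τ => C * ∑' Q : A, maassTerm k D Q τ) N ∧
      ∀ z ∈ N, hypLaplacian (2 - 2 * (k : ℤ))
        (toPlane fun τ => C * ∑' Q : A, maassTerm k D Q τ) z = 0 := by
  obtain ⟨r, hr, hball⟩ := exists_ball_circleFun_ne_zero hD hsq hA hτ
  have hδ := half_pos τ.im_pos
  have hpos : ∀ z ∈ ball (τ : ℂ) r, 0 < z.im := fun z hz => hδ.trans_le (hball z hz).1
  obtain ⟨M, hM⟩ := exists_norm_planeTerm_le_of_norm_le hk hD (‖(τ : ℂ)‖ + 1) hδ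
  obtain ⟨M', hM', hf⟩ := exists_one_div_norm_eval_sq_le hD (B := ‖(τ : ℂ)‖ + 1) hδ
  set f : A → ℂ → ℂ := fun Q z => -Complex.I * (√D : ℂ) ^ (2 * k - 1) / Q.1.eval z 1 ^ k with hfdef
  have hfd : ∀ Q, DifferentiableOn ℂ (f Q) (ball (τ : ℂ) r) := fun Q z hz =>
    ((differentiableAt_const _).div ((Q.1.hasDerivAt_eval z).differentiableAt.pow k)
      (pow_ne_zero _ (eval_ne_zero hD (hA Q.2) (hpos z hz)))).differentiableWithinAt
  have hv := (((summable_subset hsq hA).mul_left M').mul_left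
    (√D ^ (2 * k - 1) / (√D * (τ.im / 2)) ^ (k - 2)))
  have hfv : ∀ Q : A, ∀ z ∈ ball (τ : ℂ) r, ‖f Q z‖ ≤ √D ^ (2 * k - 1) /
      (√D * (τ.im / 2)) ^ (k - 2) * (M' * (1 / (1 + |(Q.1.b : ℝ)|) ^ 2)) := fun Q z hz =>
    (norm_cauchyRiemannOp_density_le hk hD (hA Q.2) hδ (hball z hz).1).trans
      (mul_le_mul_of_nonneg_left (hf Q (hA Q.2) z (hball z hz).1
        ((Complex.abs_re_le_norm z).trans (hball z hz).2.1)) (by positivity))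
  obtain ⟨han, hcr⟩ := analyticOnNhd_tsum_of_cauchyRiemannOp_eq hr (2 * k - 2)
    (g := fun (Q : A) z => planeTerm k D Q z) (f := f) ((summable_subset hsq hA).mul_left M) hv
    (fun Q z hz => (cauchyRiemannOp_planeTerm hk hD (hA Q.2) (hpos z hz)
      ((hball z hz).2.2 Q Q.2)).1) hfd
    (fun Q z hz => (cauchyRiemannOp_planeTerm hk hD (hA Q.2) (hpos z hz)
      ((hball z hz).2.2 Q Q.2)).2)
    (fun Q z hz => hM Q (hA Q.2) z (hball z hz).1 (hball z hz).2.1) hfv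
  have hfsum : DifferentiableOn ℂ (fun z => ∑' Q, f Q z) (ball (τ : ℂ) r) :=
    Complex.differentiableOn_tsum_of_summable_norm hv hfd isOpen_ball hfv
  have hev : ∀ z ∈ ball (τ : ℂ) r, toPlane (fun τ => C * ∑' Q : A, maassTerm k D Q τ) =ᶠ[𝓝 z]
      fun w => C * ∑' Q : A, planeTerm k D Q w := fun z hz =>
    Filter.eventuallyEq_of_mem (isOpen_ball.mem_nhds hz) fun w hw =>
      toPlane_tsum_maassTerm C (hpos w hw)
  have hanF : AnalyticOnNhd ℝ (toPlane fun τ => C * ∑' Q : A, maassTerm k D Q τ)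
      (ball (τ : ℂ) r) := fun z hz => (analyticAt_const.mul (han z hz)).congr (hev z hz).symm
  refine ⟨ball τ r, isOpen_ball, mem_ball_self hr, hpos, hanF, fun z hz => ?_⟩
  -- The density enters conjugated, so the outer constant `C` must appear in it as `conj C`.
  refine hypLaplacian_eq_zero_of_cauchyRiemannOp_eq isOpen_ball (2 * k - 2) (by omega) hanF
    (f := fun z => conj C * ∑' Q, f Q z) (hfsum.const_mul _) (fun w hw => ?_) hz
  rw [(hev w hw).cauchyRiemannOp_eq, cauchyRiemannOp_mul (differentiableAt_const C)
    (han w hw).differentiableAt, hcr w hw, map_mul, Complex.conj_conj]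
  ring

end Harmonic

/-! ### Vertical limits at every point. -/

section OneSided

variable {D : ℤ} {A : Set IntBinForm}

/-- The limit of `sgn (a |z| ^ 2 + b x + c)` when `z` tends to `z₀` vertically, from above if `ε = 1`
and from below if `ε = -1`. -/
def signLimit (ε : ℝ) (Q : IntBinForm) (z₀ : ℂ) : ℝ :=
  if Q.circleFun z₀ = 0 then Real.sign (Q.a * ε) else Real.sign (Q.circleFun z₀)

theorem signLimit_add_signLimit (Q : IntBinForm) (z₀ : ℂ) :
    signLimit 1 Q z₀ + signLimit (-1) Q z₀ = 2 * Real.sign (Q.circleFun z₀) := by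
  unfold signLimit
  split_ifs with h
  · rw [h, mul_one, mul_neg_one, Real.sign_neg, Real.sign_zero]; ring
  · ring

theorem circleFun_add_I_mul (Q : IntBinForm) (z : ℂ) (t : ℝ) :
    Q.circleFun (z + Complex.I * t) = Q.circleFun z + Q.a * t * (2 * z.im + t) := by
  rw [IntBinForm.circleFun, IntBinForm.circleFun, Complex.sq_norm, Complex.sq_norm,
    Complex.normSq_apply, Complex.normSq_apply]
  simp
  ring

theorem tendsto_vertical (z : ℂ) (ε : ℝ) :
    Filter.Tendsto (fun w : ℝ => z + Complex.I * ((ε * w : ℝ) : ℂ)) (𝓝[>] 0) (𝓝 z) := by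
  have h : Continuous fun w : ℝ => z + Complex.I * ((ε * w : ℝ) : ℂ) := by fun_prop
  have := h.tendsto 0
  simp only [mul_zero, Complex.ofReal_zero, add_zero] at this
  exact this.mono_left nhdsWithin_le_nhds

theorem sign_circleFun_vertical {z : ℂ} (hz : 0 < z.im) {ε : ℝ} (hε : |ε| = 1)
    (Q : IntBinForm) :
    ∀ᶠ w : ℝ in 𝓝[>] 0, Real.sign (Q.circleFun (z + Complex.I * ((ε * w : ℝ) : ℂ))) =
      signLimit ε Q z := by
  by_cases hc : Q.circleFun z = 0
  · have hw : ∀ᶠ w : ℝ in 𝓝[>] 0, w < z.im :=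
      (continuous_id.continuousAt.eventually_lt_const hz).filter_mono nhdsWithin_le_nhds
    filter_upwards [self_mem_nhdsWithin, hw] with w hw0 hwz
    have hw0' : 0 < w := hw0
    have habs : |ε * w| = w := by rw [abs_mul, hε, one_mul, abs_of_pos hw0']
    have hp : 0 < w * (2 * z.im + ε * w) := mul_pos hw0' (by linarith [neg_abs_le (ε * w)])
    have e : Q.circleFun (z + Complex.I * ((ε * w : ℝ) : ℂ)) =
        Q.a * ε * (w * (2 * z.im + ε * w)) := by
      rw [circleFun_add_I_mul, hc]; ring
    rw [e, signLimit, if_pos hc]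
    rcases lt_trichotomy ((Q.a : ℝ) * ε) 0 with h | h | h
    · rw [Real.sign_of_neg h, Real.sign_of_neg (mul_neg_of_neg_of_pos h hp)]
    · rw [h, zero_mul]
    · rw [Real.sign_of_pos h, Real.sign_of_pos (mul_pos h hp)]
  · filter_upwards [(tendsto_vertical z ε).eventually (sign_circleFun_eventuallyEq hc)] with w hw
    rw [hw, signLimit, if_neg hc]

/-- For each form the sign is eventually constant and the unsigned term is continuous even across
`S_Q`; dominated convergence passes to the sum although signs of infinitely many forms are involved.
-/
theorem tendsto_toPlane_vertical {k : ℕ} (hk : 1 < k) (hD : 0 < D) (hsq : ¬ IsSquare D)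
    (hA : A ⊆ IntBinForm.ofDisc D) (C : ℂ) (τ : ℍ) {ε : ℝ} (hε : |ε| = 1) :
    Filter.Tendsto (fun w : ℝ => toPlane (fun τ => C * ∑' Q : A, maassTerm k D Q τ)
        ((τ : ℂ) + Complex.I * ((ε * w : ℝ) : ℂ))) (𝓝[>] 0)
      (𝓝 (C * ∑' Q : A, (signLimit ε Q τ : ℂ) * unsignedTerm k D Q τ)) := by
  have hδ := half_pos τ.im_pos
  have h1 : ∀ᶠ z : ℂ in 𝓝 (τ : ℂ), τ.im / 2 < z.im :=
    Complex.continuous_im.continuousAt.eventually_const_lt (by simpa using τ.im_pos)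
  have h2 : ∀ᶠ z : ℂ in 𝓝 (τ : ℂ), ‖z‖ < ‖(τ : ℂ)‖ + 1 :=
    continuous_norm.continuousAt.eventually_lt_const (by linarith)
  have hev := (tendsto_vertical τ ε).eventually (h1.and h2)
  obtain ⟨M, hM⟩ := exists_norm_planeTerm_le_of_norm_le hk hD (‖(τ : ℂ)‖ + 1) hδ
  have hlim : Filter.Tendsto (fun w : ℝ => C * ∑' Q : A, planeTerm k D Q
      ((τ : ℂ) + Complex.I * ((ε * w : ℝ) : ℂ))) (𝓝[>] 0)
      (𝓝 (C * ∑' Q : A, (signLimit ε Q τ : ℂ) * unsignedTerm k D Q τ)) := by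
    refine Filter.Tendsto.const_mul C (tendsto_tsum_of_dominated_convergence
      ((summable_subset hsq hA).mul_left M) (fun Q => ?_) ?_)
    · refine Filter.Tendsto.congr' ?_ (((continuousAt_unsignedTerm hk hD (hA Q.2)
        τ.im_pos).tendsto.comp (tendsto_vertical τ ε)).const_mul (signLimit ε Q τ : ℂ))
      filter_upwards [sign_circleFun_vertical τ.im_pos hε Q.1] with w hw
      rw [planeTerm, ← hw]; rfl
    · filter_upwards [hev] with w hw Q
      exact hM Q (hA Q.2) _ hw.1.le hw.2.le
  refine hlim.congr' ?_
  filter_upwards [hev] with w hw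
  exact (toPlane_tsum_maassTerm C (hδ.trans hw.1)).symm

theorem tendsto_toPlane_above {k : ℕ} (hk : 1 < k) (hD : 0 < D) (hsq : ¬ IsSquare D)
    (hA : A ⊆ IntBinForm.ofDisc D) (C : ℂ) (τ : ℍ) :
    Filter.Tendsto (fun w : ℝ => toPlane (fun τ => C * ∑' Q : A, maassTerm k D Q τ)
        ((τ : ℂ) + Complex.I * (w : ℂ))) (𝓝[>] 0)
      (𝓝 (C * ∑' Q : A, (signLimit 1 Q τ : ℂ) * unsignedTerm k D Q τ)) := by
  simpa using tendsto_toPlane_vertical hk hD hsq hA C τ (ε := 1) (by simp)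

theorem tendsto_toPlane_below {k : ℕ} (hk : 1 < k) (hD : 0 < D) (hsq : ¬ IsSquare D)
    (hA : A ⊆ IntBinForm.ofDisc D) (C : ℂ) (τ : ℍ) :
    Filter.Tendsto (fun w : ℝ => toPlane (fun τ => C * ∑' Q : A, maassTerm k D Q τ)
        ((τ : ℂ) - Complex.I * (w : ℂ))) (𝓝[>] 0)
      (𝓝 (C * ∑' Q : A, (signLimit (-1) Q τ : ℂ) * unsignedTerm k D Q τ)) := by
  simpa [sub_eq_add_neg] using tendsto_toPlane_vertical hk hD hsq hA C τ (ε := -1) (by simp)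

end OneSided

/-! ### Average value, growth and the Maass form properties. -/

section MaassForm

variable {D : ℤ} {A : Set IntBinForm}

theorem summable_signLimit_mul_unsignedTerm {k : ℕ} (hk : 1 < k) (hD : 0 < D) (hsq : ¬ IsSquare D)
    (hA : A ⊆ IntBinForm.ofDisc D) (τ : ℍ) (ε : ℝ) :
    Summable fun Q : A => (signLimit ε Q τ : ℂ) * unsignedTerm k D Q τ := by
  obtain ⟨M, hM⟩ := exists_norm_unsignedTerm_le_of_norm_le hk hD ‖(τ : ℂ)‖ τ.im_pos
  refine Summable.of_norm_bounded ((summable_subset hsq hA).mul_left M) fun Q => ?_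
  have hsign : ‖(signLimit ε Q τ : ℂ)‖ ≤ 1 := by
    rw [signLimit]
    split_ifs <;> exact Real.norm_sign_le_one _
  rw [norm_mul]
  exact (mul_le_of_le_one_left (norm_nonneg _) hsign).trans (hM Q (hA Q.2) τ le_rfl le_rfl)

theorem average_tsum_maassTerm {k : ℕ} (hk : 1 < k) (hD : 0 < D) (hsq : ¬ IsSquare D)
    (hA : A ⊆ IntBinForm.ofDisc D) (C : ℂ) (τ : ℍ) :
    Filter.Tendsto (fun w : ℝ => (1 / 2 : ℂ) *
      (toPlane (fun τ => C * ∑' Q : A, maassTerm k D Q τ) ((τ : ℂ) + Complex.I * (w : ℂ)) +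
        toPlane (fun τ => C * ∑' Q : A, maassTerm k D Q τ) ((τ : ℂ) - Complex.I * (w : ℂ))))
      (𝓝[>] 0) (𝓝 (C * ∑' Q : A, maassTerm k D Q τ)) := by
  have h := ((tendsto_toPlane_above hk hD hsq hA C τ).add
    (tendsto_toPlane_below hk hD hsq hA C τ)).const_mul (1 / 2 : ℂ)
  have hmean : ∑' Q : A, maassTerm k D Q τ = 1 / 2 *
      (∑' Q : A, (signLimit 1 Q τ : ℂ) * unsignedTerm k D Q τ +
        ∑' Q : A, (signLimit (-1) Q τ : ℂ) * unsignedTerm k D Q τ) := by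
    rw [← (summable_signLimit_mul_unsignedTerm hk hD hsq hA τ 1).tsum_add
      (summable_signLimit_mul_unsignedTerm hk hD hsq hA τ (-1)), ← tsum_mul_left]
    refine tsum_congr fun Q => ?_
    have hs : (signLimit 1 Q τ : ℂ) + signLimit (-1) Q τ = 2 * Real.sign (Q.1.circleFun τ) := by
      exact_mod_cast signLimit_add_signLimit Q.1 τ
    rw [← add_mul, hs, maassTerm_eq_planeTerm, planeTerm]
    ring
  rw [hmean, mul_left_comm, mul_add]
  exact h

/-- On the strip `|x| ≤ 1`, `y ≥ 1` the term bound gives `y^(k+1)` times a convergent sum.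
Invariance under integer translations extends this to all `x`. -/
theorem growth_tsum_maassTerm {k : ℕ} (hk : 1 < k) (hD : 0 < D) (hsq : ¬ IsSquare D)
    (hA : A ⊆ IntBinForm.ofDisc D) (hinv : ∀ Q ∈ A, ∀ γ : SL(2, ℤ), Q.comp γ ∈ A) (C : ℂ) :
    (fun τ : ℍ => C * ∑' Q : A, maassTerm k D Q τ) =O[UpperHalfPlane.atImInfty]
      fun τ : ℍ => τ.im ^ (k + 1) := by
  obtain ⟨M, hM, hb⟩ := exists_norm_unsignedTerm_le hk hD (B := 1) zero_lt_one
  have hsum := (summable_subset hsq hA).mul_left M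
  have hstrip : ∀ τ : ℍ, 1 ≤ τ.im → |τ.re| ≤ 1 → ‖∑' Q : A, maassTerm k D Q τ‖ ≤
      τ.im ^ (k + 1) * ∑' Q : A, M * (1 / (1 + |(Q.1.b : ℝ)|) ^ 2) := fun τ hτ hre =>
    tsum_of_norm_bounded (hsum.hasSum.mul_left _) fun Q => by
      rw [maassTerm_eq_planeTerm]
      exact (norm_planeTerm_le k D Q τ).trans (hb Q (hA Q.2) τ hτ hre)
  refine Asymptotics.IsBigO.of_bound
    (‖C‖ * ∑' Q : A, M * (1 / (1 + |(Q.1.b : ℝ)|) ^ 2)) ?_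
  rw [Filter.Eventually, UpperHalfPlane.atImInfty_mem]
  refine ⟨1, fun τ hτ => ?_⟩
  -- This translation brings `x` into `[0, 1)`; it preserves `y` and has trivial automorphy factor.
  set n : ℤ := -⌊τ.re⌋
  have hper := congrFun (slash_tsum_maassTerm (ModularGroup.T ^ n) hk D hinv C) τ
  rw [ModularForm.SL_slash_apply, ModularGroup.denom_apply, ModularGroup.coe_T_zpow] at hper
  simp only [Matrix.of_apply, Matrix.cons_val', Matrix.cons_val_zero, Matrix.cons_val_one,
    Int.cast_zero, zero_mul, zero_add, Int.cast_one, one_zpow, mul_one] at hper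
  have him := ModularGroup.im_T_zpow_smul τ n
  have hre : |(ModularGroup.T ^ n • τ).re| ≤ 1 := by
    rw [ModularGroup.re_T_zpow_smul, abs_le]
    have h1 := Int.floor_le τ.re
    have h2 := Int.lt_floor_add_one τ.re
    simp only [n, Int.cast_neg]
    constructor <;> linarith
  have h := hstrip (ModularGroup.T ^ n • τ) (him.symm ▸ hτ) hre
  rw [him] at h
  show ‖C * ∑' Q : A, maassTerm k D Q τ‖ ≤ _
  rw [← hper, norm_mul, Real.norm_of_nonneg (pow_nonneg τ.im_pos.le _)]
  calc _ ≤ ‖C‖ * _ := mul_le_mul_of_nonneg_left h (norm_nonneg C)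
    _ = _ := by ring

theorem isLocallyHarmonicMaassForm_tsum_maassTerm {k : ℕ} (hk : 1 < k) (hD : 0 < D)
    (hsq : ¬ IsSquare D) (hA : A ⊆ IntBinForm.ofDisc D)
    (hinv : ∀ Q ∈ A, ∀ γ : SL(2, ℤ), Q.comp γ ∈ A) (C : ℂ) :
    IsLocallyHarmonicMaassForm (2 - 2 * (k : ℤ)) (exceptionalSet D)
      (fun τ => C * ∑' Q : A, maassTerm k D Q τ) where
  slash_eq γ := slash_tsum_maassTerm γ hk D hinv C
  locally_harmonic _ hτ := locally_harmonic_tsum_maassTerm hk hD hsq hA C hτ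
  average τ _ := average_tsum_maassTerm hk hD hsq hA C τ
  growth := ⟨k + 1, growth_tsum_maassTerm hk hD hsq hA hinv C⟩

theorem hasOneSidedLimits_tsum_maassTerm {k : ℕ} (hk : 1 < k) (hD : 0 < D)
    (hsq : ¬ IsSquare D) (hA : A ⊆ IntBinForm.ofDisc D) (C : ℂ) :
    HasOneSidedLimits (exceptionalSet D) (fun τ => C * ∑' Q : A, maassTerm k D Q τ) :=
  fun τ _ => ⟨_, _, tendsto_toPlane_above hk hD hsq hA C τ, tendsto_toPlane_below hk hD hsq hA C τ⟩

end MaassForm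

end

theorem theorem1p1 (k : ℕ) (hk : 1 < k) (D : ℤ) (hD : 0 < D) (hdisc : D % 4 = 0 ∨ D % 4 = 1)
    (hsq : ¬ IsSquare D) :
    (ConvergesCompactly (fun (Q : IntBinForm.ofDisc D) (τ : ℍ) => maassTerm k D Q τ) ∧
      IsLocallyHarmonicMaassForm (2 - 2 * (k : ℤ)) (exceptionalSet D) (maassF k D) ∧
      HasOneSidedLimits (exceptionalSet D) (maassF k D)) ∧
    ∀ Q₀ ∈ IntBinForm.ofDisc D,
      ConvergesCompactly (fun (Q : Q₀.narrowClass) (τ : ℍ) => maassTerm k D Q τ) ∧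
      IsLocallyHarmonicMaassForm (2 - 2 * (k : ℤ)) (exceptionalSet D)
        (maassFNarrow k D Q₀.narrowClass) ∧
      HasOneSidedLimits (exceptionalSet D) (maassFNarrow k D Q₀.narrowClass) := by
  refine ⟨⟨convergesCompactly_maassTerm hk hD hsq subset_rfl,
    isLocallyHarmonicMaassForm_tsum_maassTerm hk hD hsq subset_rfl
      (fun _ hQ γ => IntBinForm.comp_mem_ofDisc hQ γ) _,
    hasOneSidedLimits_tsum_maassTerm hk hD hsq subset_rfl _⟩, fun Q₀ hQ₀ => ?_⟩
  have hA := IntBinForm.narrowClass_subset_ofDisc hQ₀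
  exact ⟨convergesCompactly_maassTerm hk hD hsq hA,
    isLocallyHarmonicMaassForm_tsum_maassTerm hk hD hsq hA
      (fun _ hQ γ => IntBinForm.comp_mem_narrowClass hQ γ) _,
    hasOneSidedLimits_tsum_maassTerm hk hD hsq hA _⟩
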